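/- For $z$ in the upper half-plane $\mathbb{H}$ put $q=e^{2\pi i z}$ and $f'=\frac1{2\pi i}\frac{df}{dz}$. Let $E_2=1-24\sum_{n\ge1}\sigma_1(n)q^n$, $E_4=1+240\sum_{n\ge1}\sigma_3(n)q^n$, $E_6=1-504\sum_{n\ge1}\sigma_5(n)q^n$ and $\Delta=\frac1{1728}(E_4^3-E_6^2)$. Consider the sequence $(f_w)$ ($w\equiv2\pmod 4$, $w\ge10$) of functions on $\mathbb{H}$ given by the initial elements $$f_{10}=-E_4E_6+2E_2E_4^2-E_2^2E_6,$$ $$f_{14}=-\tfrac1{8400}\left(E_4^2E_6-E_2(E_4^3+E_6^2)+E_2^2E_4E_6\right),$$ $$f_{18}=-\tfrac1{1995840000}\left(5E_4^3E_6+7E_6^3-E_2(5E_4^4+19E_4E_6^2)+12E_2^2E_4^2E_6\right)$$ and, for $w\ge18$, $w\equiv2\pmod4$, by the recurrence $$f_{w+4}=\frac{200(w-9)(w-10)(w^2-21w+92)E_4f_w-\frac58(w-10)(w-14)E_4^2f_{w-4}+\Delta f_{w-8}}{16000(w-3)(w-4)(w-5)(w-9)(w-11)(w-16)}.$$ Then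 $$f_{10}=-\tfrac{24}7E_6'',\qquad f_{14}=-\tfrac3{19250}(E_4E_6)''-\tfrac{36}{875}E_2\Delta,\qquad f_{18}=-\tfrac1{242550000}(E_4^2E_6)''+\tfrac{\Delta(181E_6-185E_2E_4)}{40425000},$$ and for every $w\equiv2\pmod4$, $w\ge10$, the following hold. (1) $f=f_w$ satisfies the differential equation $$\begin{aligned}&E_6f'''-\left(\tfrac{w-2}4E_4^2+\tfrac w2E_6'\right)f''+\left(\tfrac{w-6}4E_4E_6+\tfrac{(w-1)(w-2)}8E_4E_4'+\tfrac{w(w-1)}{14}E_6''\right)f'\\&-\left(\tfrac{(w-2)(w-6)}{24}E_4E_6'+\tfrac{5(w-8)(w-9)(w-10)}{384}(E_4')^2+\tfrac{w^3+105w^2-1162w+3576}{480}E_4E_4''+\tfrac{w(w-1)(w-2)}{336}E_6'''\right)f=0.\end{aligned}$$ (2) There are unique holomorphic modular forms $A_w$, $B_w$, $C_w$ for $\mathrm{SL}(2,\mathbb{Z})$ of respective weights $w$, $w-2$, $w-4$ such that $f_w=A_w-2E_2B_w+E_2^2C_w$; thus $f_w$ is a quasimodular form of weight $w$. (3) Put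 $g_w=B_w-E_2C_w$ and $h_w=C_w$. The exact orders of $f_w$, $g_w$ and $h_w$ for $q\to0$ are $q^{(w-6)/4}$, $q$ and $1$; that is, $f_w/q^{(w-6)/4}$, $g_w/q$ and $h_w$ have finite non-zero limits as $\operatorname{Im}z\to\infty$. -/

import Mathlib

open UpperHalfPlane ModularForm EisensteinSeries Derivative
open scoped MatrixGroups Topology

noncomputable section

namespace QuasimodularRecurrence

/-- `F` has exact order `q ^ m` for `q → 0` (that is, `Im z → ∞`), where `q = exp (2 π i z)`:
the quotient `F / q ^ m` has a finite non-zero limit. -/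
def HasExactOrder (F : ℍ → ℂ) (m : ℕ) : Prop :=
  ∃ c : ℂ, c ≠ 0 ∧
    Filter.Tendsto (fun z : ℍ => F z / Function.Periodic.qParam 1 (z : ℂ) ^ m) atImInfty (𝓝 c)

/-- `F = A - 2 E₂ B + E₂² C` with holomorphic modular forms `A`, `B`, `C` for `SL(2, ℤ)` of weights
`w`, `w - 2`, `w - 4`: a quasimodular form of weight `w` and depth at most `2`. -/
def IsDecomposition (w : ℤ) (F : ℍ → ℂ) (A : ModularForm 𝒮ℒ w) (B : ModularForm 𝒮ℒ (w - 2))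
    (C : ModularForm 𝒮ℒ (w - 4)) : Prop :=
  ∀ z : ℍ, F z = A z - 2 * E2 z * B z + E2 z ^ 2 * C z

/-- The third order linear differential equation with leading coefficient `E₆` and parameter `w`;
`D` is the derivation `(2 π i)⁻¹ d/dz`. -/
def SolvesODE (w : ℂ) (F : ℍ → ℂ) : Prop :=
  ∀ z : ℍ,
    E₆ z * (D^[3] F) z
      - ((w - 2) / 4 * E₄ z ^ 2 + w / 2 * (D E₆) z) * (D^[2] F) z
      + ((w - 6) / 4 * (E₄ z * E₆ z) + (w - 1) * (w - 2) / 8 * (E₄ z * (D E₄) z)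
          + w * (w - 1) / 14 * (D^[2] E₆) z) * (D F) z
      - ((w - 2) * (w - 6) / 24 * (E₄ z * (D E₆) z)
          + 5 * (w - 8) * (w - 9) * (w - 10) / 384 * (D E₄) z ^ 2
          + (w ^ 3 + 105 * w ^ 2 - 1162 * w + 3576) / 480 * (E₄ z * (D^[2] E₄) z)
          + w * (w - 1) * (w - 2) / 336 * (D^[3] E₆) z) * F z = 0

/-- The sequence `f w` (only the indices `w ≡ 2 (mod 4)`, `w ≥ 10` matter): three initial elements
of weights `10`, `14`, `18`, and a three-term recurrence which gives `f (w + 4)` for `w ≥ 18`. -/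
structure IsRecurrenceSequence (f : ℕ → ℍ → ℂ) : Prop where
  init_ten : ∀ z : ℍ,
    f 10 z = -(E₄ z * E₆ z) + 2 * E2 z * E₄ z ^ 2 - E2 z ^ 2 * E₆ z
  init_fourteen : ∀ z : ℍ,
    f 14 z = -(1 / 8400) * (E₄ z ^ 2 * E₆ z - E2 z * (E₄ z ^ 3 + E₆ z ^ 2)
      + E2 z ^ 2 * E₄ z * E₆ z)
  init_eighteen : ∀ z : ℍ,
    f 18 z = -(1 / 1995840000) * (5 * E₄ z ^ 3 * E₆ z + 7 * E₆ z ^ 3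
      - E2 z * (5 * E₄ z ^ 4 + 19 * E₄ z * E₆ z ^ 2) + 12 * E2 z ^ 2 * E₄ z ^ 2 * E₆ z)
  recurrence : ∀ w : ℕ, 18 ≤ w → w % 4 = 2 → ∀ z : ℍ,
    f (w + 4) z =
      1 / (16000 * ((w : ℂ) - 3) * (w - 4) * (w - 5) * (w - 9) * (w - 11) * (w - 16)) *
        (200 * ((w : ℂ) - 9) * (w - 10) * (w ^ 2 - 21 * w + 92) * E₄ z * f w z
          - 5 / 8 * ((w : ℂ) - 10) * (w - 14) * E₄ z ^ 2 * f (w - 4) z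
          + discriminant z * f (w - 8) z)

end QuasimodularRecurrence

end

open scoped Manifold

namespace QuasimodularRecurrence

/-! ### Leading terms at `i∞` -/

/-! By Ramanujan's identities, any differential relation for a single `f w` is a polynomial identity
in `E2`, `E₄`, `E₆`; the difficulty is uniformity in `w`. The differential equation is not carried
along the recurrence directly. Two contiguity relations are: `E₆` times a Serre-type derivative of
`f w` is a combination of `f w`, `f (w + 4)`, `f (w + 8)`, and a second order operator applied to `f
w` is a combination of `f w` and `f (w + 4)`. Both are checked at `w = 10, 14, 18` and then
propagated by differentiating the recurrence (`FirstOrderRel.step`, `SecondOrderRel.step`).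
Differentiating the second relation once more and eliminating the neighbours of `f w` gives the
differential equation (`ode_of_rel`).

The recurrence is linear with modular coefficients, so it acts separately on the components `A`,
`B`, `C`, which gives the decomposition; uniqueness comes from the inhomogeneous transformation law
of `E2` (`eq_zero_of_decomposition`). Since `Δ` vanishes at the cusp, the leading coefficients of
`C` and `B - E2 C` obey a numerical three-term recurrence, which is solved by products without zero
factors (`leadC_rec`, `leadG_rec`).

For the order of `f w`, the indicial roots of the equation at the cusp are `0`, `1` and `(w - 6) /
4` (`SolvesODE.exponent`). The function is non-zero because `C` is, it vanishes at the cusp, and it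
vanishes at least doubly once `w ≥ 14`; only the third root survives. -/

/-- A holomorphic function on `ℍ` that vanishes near `i∞` is zero. -/
lemma eq_zero_of_eventually_eq_zero {F : ℍ → ℂ} (hF : MDiff F)
    (h : ∀ᶠ z in atImInfty, F z = 0) : F = 0 := by
  obtain ⟨A, hA⟩ := (atImInfty_mem _).mp h
  have hd := UpperHalfPlane.mdifferentiable_iff.mp hF
  have hopen : IsOpen {z : ℂ | 0 < z.im} := isOpen_lt continuous_const Complex.continuous_im
  have han : AnalyticOnNhd ℂ (F ∘ ofComplex) {z : ℂ | 0 < z.im} := hd.analyticOnNhd hopen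
  have hpre : IsPreconnected {z : ℂ | 0 < z.im} := (convex_halfSpace_im_gt 0).isPreconnected
  -- The point `(max A 0 + 1) i` lies both in the upper half-plane and above the height `A`, so it
  -- can serve as base point of the identity theorem.
  have him : ((max A 0 + 1 : ℝ) * Complex.I).im = max A 0 + 1 := by simp
  have hmax : A < max A 0 + 1 := by linarith [le_max_left A 0]
  have hmax0 : 0 < max A 0 + 1 := by linarith [le_max_right A 0]
  have hev : F ∘ ofComplex =ᶠ[𝓝 ((max A 0 + 1 : ℝ) * Complex.I)] 0 := by
    have h1 : ∀ᶠ w : ℂ in 𝓝 ((max A 0 + 1 : ℝ) * Complex.I), 0 < w.im :=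
      hopen.mem_nhds (by simp only [Set.mem_ofPred_eq, him]; exact hmax0)
    have h2 : ∀ᶠ w : ℂ in 𝓝 ((max A 0 + 1 : ℝ) * Complex.I), A < w.im :=
      (isOpen_lt continuous_const Complex.continuous_im).mem_nhds
        (by simp only [Set.mem_ofPred_eq, him]; exact hmax)
    filter_upwards [h1, h2] with w hw hw'
    have := hA ⟨w, hw⟩ hw'.le
    simpa [ofComplex_apply_of_im_pos hw] using this
  have := han.eqOn_zero_of_preconnected_of_eventuallyEq_zero hpre
    (by simp only [Set.mem_ofPred_eq, him]; exact hmax0) hev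
  ext z
  simpa using this z.im_pos

/-- Near `i∞` the function `F` equals `q ^ n * G q` with `G` analytic at `0` and `G 0 = c`
(where `c = 0` is allowed). -/
def HasLeadingTerm (F : ℍ → ℂ) (n : ℕ) (c : ℂ) : Prop :=
  ∃ G : ℂ → ℂ, AnalyticAt ℂ G 0 ∧ G 0 = c ∧ ∀ᶠ z : ℍ in atImInfty,
    F z = Function.Periodic.qParam 1 (z : ℂ) ^ n * G (Function.Periodic.qParam 1 (z : ℂ))

namespace HasLeadingTerm

variable {F F₁ F₂ : ℍ → ℂ} {n m : ℕ} {c c₁ c₂ : ℂ}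

lemma congr (h : HasLeadingTerm F₁ n c) (hF : ∀ z, F₂ z = F₁ z) : HasLeadingTerm F₂ n c := by
  obtain rfl : F₂ = F₁ := funext hF
  exact h

lemma const (c : ℂ) : HasLeadingTerm (fun _ => c) 0 c :=
  ⟨fun _ => c, analyticAt_const, rfl, by simp⟩

lemma add (h₁ : HasLeadingTerm F₁ n c₁) (h₂ : HasLeadingTerm F₂ n c₂) :
    HasLeadingTerm (fun z => F₁ z + F₂ z) n (c₁ + c₂) := by
  obtain ⟨G₁, ha₁, hc₁, he₁⟩ := h₁
  obtain ⟨G₂, ha₂, hc₂, he₂⟩ := h₂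
  refine ⟨fun q => G₁ q + G₂ q, ha₁.add ha₂, by simp [hc₁, hc₂], ?_⟩
  filter_upwards [he₁, he₂] with z h₁ h₂
  rw [h₁, h₂]; ring

lemma mul (h₁ : HasLeadingTerm F₁ n c₁) (h₂ : HasLeadingTerm F₂ m c₂) :
    HasLeadingTerm (fun z => F₁ z * F₂ z) (n + m) (c₁ * c₂) := by
  obtain ⟨G₁, ha₁, hc₁, he₁⟩ := h₁
  obtain ⟨G₂, ha₂, hc₂, he₂⟩ := h₂
  refine ⟨fun q => G₁ q * G₂ q, ha₁.mul ha₂, by simp [hc₁, hc₂], ?_⟩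
  filter_upwards [he₁, he₂] with z h₁ h₂
  rw [h₁, h₂]; ring

lemma const_mul (a : ℂ) (h : HasLeadingTerm F n c) :
    HasLeadingTerm (fun z => a * F z) n (a * c) := by
  simpa using (const a).mul h

lemma sub (h₁ : HasLeadingTerm F₁ n c₁) (h₂ : HasLeadingTerm F₂ n c₂) :
    HasLeadingTerm (fun z => F₁ z - F₂ z) n (c₁ - c₂) := by
  have := h₁.add (h₂.const_mul (-1))
  rw [show c₁ + -1 * c₂ = c₁ - c₂ by ring] at this
  exact this.congr fun z => by ring

lemma pow (h : HasLeadingTerm F 0 c) (k : ℕ) : HasLeadingTerm (fun z => F z ^ k) 0 (c ^ k) := by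
  induction k with
  | zero => simpa using const 1
  | succ k ih => simpa [pow_succ] using ih.mul h

lemma weaken (h : HasLeadingTerm F (n + 1) c) : HasLeadingTerm F n 0 := by
  obtain ⟨G, ha, hc, he⟩ := h
  refine ⟨fun q => q * G q, analyticAt_id.mul ha, by simp, ?_⟩
  filter_upwards [he] with z h
  rw [h]; ring

lemma exists_of_le (h : HasLeadingTerm F n c) (hm : m ≤ n) : ∃ d, HasLeadingTerm F m d := by
  induction n, hm using Nat.le_induction generalizing c with
  | base => exact ⟨c, h⟩
  | succ k hk ih => exact ih h.weaken

lemma tendsto (h : HasLeadingTerm F n c) :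
    Filter.Tendsto (fun z : ℍ => F z / Function.Periodic.qParam 1 (z : ℂ) ^ n)
      atImInfty (𝓝 c) := by
  obtain ⟨G, ha, rfl, he⟩ := h
  refine (ha.continuousAt.tendsto.comp (qParam_tendsto_atImInfty one_pos)).congr' ?_
  filter_upwards [he] with z h
  have := pow_ne_zero n (Function.Periodic.qParam_ne_zero (h := 1) (z : ℂ))
  rw [h, Function.comp_apply]
  field_simp

lemma tendsto_zero_exponent (h : HasLeadingTerm F 0 c) :
    Filter.Tendsto F atImInfty (𝓝 c) := by simpa using h.tendsto

lemma unique (h₁ : HasLeadingTerm F n c₁) (h₂ : HasLeadingTerm F n c₂) : c₁ = c₂ :=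
  tendsto_nhds_unique h₁.tendsto h₂.tendsto

lemma hasExactOrder (h : HasLeadingTerm F n c) (hc : c ≠ 0) : HasExactOrder F n :=
  ⟨c, hc, h.tendsto⟩

lemma isBoundedAtImInfty (h : HasLeadingTerm F 0 c) : IsBoundedAtImInfty F :=
  h.tendsto_zero_exponent.isBigO_one ℝ

/-- The normalized derivative multiplies the leading coefficient by the exponent. -/
lemma deriv (h : HasLeadingTerm F n c) : HasLeadingTerm (D F) n (n * c) := by
  obtain ⟨G, ha, rfl, he⟩ := h
  refine ⟨fun q => n * G q + q * _root_.deriv G q,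
    (analyticAt_const.mul ha).add (analyticAt_id.mul ha.deriv), by simp, ?_⟩
  obtain ⟨A, hA⟩ := (atImInfty_mem _).mp he
  have hq := (qParam_tendsto_atImInfty one_pos).eventually ha.eventually_analyticAt
  have hlt : ∀ᶠ z : ℍ in atImInfty, A < z.im :=
    (atImInfty_mem _).mpr ⟨A + 1, fun z hz => by simp only [Set.mem_ofPred_eq]; linarith⟩
  filter_upwards [hq, hlt] with z hz hAz
  have hpi : (2 * Real.pi * Complex.I : ℂ) ≠ 0 := Complex.two_pi_I_ne_zero
  have hqd : HasDerivAt (Function.Periodic.qParam 1)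
      (Function.Periodic.qParam 1 z * (2 * Real.pi * Complex.I)) (z : ℂ) := by
    have h0 : HasDerivAt (fun w : ℂ => 2 * Real.pi * Complex.I * w / ((1 : ℝ) : ℂ))
        (2 * Real.pi * Complex.I) (z : ℂ) := by
      simpa using (hasDerivAt_id (z : ℂ)).const_mul (2 * Real.pi * Complex.I)
    exact h0.cexp
  have hev : F ∘ ofComplex =ᶠ[𝓝 (z : ℂ)] fun w =>
      Function.Periodic.qParam 1 w ^ n * G (Function.Periodic.qParam 1 w) := by
    have h1 : ∀ᶠ w : ℂ in 𝓝 (z : ℂ), 0 < w.im :=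
      (isOpen_lt continuous_const Complex.continuous_im).mem_nhds z.im_pos
    have h2 : ∀ᶠ w : ℂ in 𝓝 (z : ℂ), A < w.im :=
      (isOpen_lt continuous_const Complex.continuous_im).mem_nhds hAz
    filter_upwards [h1, h2] with w hw hw'
    have := hA ⟨w, hw⟩ hw'.le
    simpa [ofComplex_apply_of_im_pos hw] using this
  have hG := hz.differentiableAt.hasDerivAt
  have hd := ((hqd.pow n).mul (hG.comp (z : ℂ) hqd)).congr_of_eventuallyEq hev
  rw [normalizedDerivOfComplex, hd.deriv]
  have hi : (2 * Real.pi * Complex.I : ℂ)⁻¹ * (2 * Real.pi * Complex.I) = 1 :=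
    inv_mul_cancel₀ hpi
  simp only [Function.comp_apply, Pi.pow_apply]
  -- The derivative of `q ^ n` contains `q ^ (n - 1)` with truncated subtraction, so `n = 0` is
  -- treated apart.
  rcases n with _ | n
  · simp only [Nat.cast_zero]
    linear_combination (Function.Periodic.qParam 1 z *
      _root_.deriv G (Function.Periodic.qParam 1 z)) * hi
  · simp only [Nat.add_sub_cancel]
    linear_combination ((n + 1 : ℕ) * Function.Periodic.qParam 1 z ^ (n + 1) *
      G (Function.Periodic.qParam 1 z) + Function.Periodic.qParam 1 z ^ (n + 2) *
      _root_.deriv G (Function.Periodic.qParam 1 z)) * hi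

/-- A periodic holomorphic function bounded at `i∞` has a leading term of exponent `0`. -/
lemma of_periodic (hper : Function.Periodic (F ∘ ofComplex) 1) (hF : MDiff F)
    (hb : IsBoundedAtImInfty F) : HasLeadingTerm F 0 (cuspFunction 1 F 0) :=
  ⟨cuspFunction 1 F, analyticAt_cuspFunction_zero one_pos (by simpa using hper) hF hb, rfl,
    .of_forall fun z => by
      simpa using (eq_cuspFunction z one_ne_zero (by simpa using hper)).symm⟩

/-- The linear coefficient of a leading expansion of exponent `0`. -/
lemma sub_const {G : ℂ → ℂ} (ha : AnalyticAt ℂ G 0)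
    (hG : ∀ z : ℍ, F z = G (Function.Periodic.qParam 1 (z : ℂ))) :
    HasLeadingTerm (fun z => F z - G 0) 1 (_root_.deriv G 0) := by
  -- `dslope G 0` is the quotient `(G q - G 0) / q`, extended by the derivative at `q = 0`.
  refine ⟨dslope G 0, ?_, dslope_same G 0, .of_forall fun z => ?_⟩
  · obtain ⟨p, hp⟩ := ha
    exact ⟨_, hp.has_fpower_series_dslope_fslope⟩
  · have := sub_smul_dslope G 0 (Function.Periodic.qParam 1 (z : ℂ))
    simpa [hG] using this.symm

/-- A nonzero holomorphic function that is meromorphic at `i∞` has a nonzero leading term. -/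
lemma exists_ne_zero (h : HasLeadingTerm F m c) (hF : MDiff F) (h0 : F ≠ 0) :
    ∃ n d, d ≠ 0 ∧ HasLeadingTerm F n d := by
  obtain ⟨G, ha, rfl, he⟩ := h
  by_cases hz : ∀ᶠ q in 𝓝 (0 : ℂ), G q = 0
  · refine absurd (eq_zero_of_eventually_eq_zero hF ?_) h0
    filter_upwards [he, (qParam_tendsto_atImInfty one_pos).eventually hz] with z h1 h2
    rw [h1, h2, mul_zero]
  · obtain ⟨n, g, hg, hg0, hgG⟩ := ha.exists_eventuallyEq_pow_smul_nonzero_iff.mpr hz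
    refine ⟨m + n, g 0, hg0, g, hg, rfl, ?_⟩
    filter_upwards [he, (qParam_tendsto_atImInfty one_pos).eventually hgG] with z h1 h2
    rw [h1, h2, sub_zero, smul_eq_mul, pow_add, mul_assoc]

/-- A non-zero leading coefficient fixes the exact order; an expansion with a larger exponent would
force that coefficient to be `0`. -/
lemma le_of_ne_zero (h₁ : HasLeadingTerm F n c₁) (hc : c₁ ≠ 0) (h₂ : HasLeadingTerm F m c₂) :
    m ≤ n := by
  by_contra! hlt
  obtain ⟨d, hd⟩ := h₂.exists_of_le hlt
  exact hc (h₁.unique hd.weaken)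

end HasLeadingTerm

/-! ### Normalized derivatives -/

/-- The function `F` is holomorphic on `ℍ`, and its normalized derivative is the second argument. -/
def HasNormalizedDeriv (F F' : ℍ → ℂ) : Prop := MDiff F ∧ D F = F'

namespace HasNormalizedDeriv

variable {F F' F₁ F₁' F₂ F₂' : ℍ → ℂ}

lemma of_mdifferentiable (h : MDiff F) : HasNormalizedDeriv F (D F) := ⟨h, rfl⟩

lemma apply (h : HasNormalizedDeriv F F') (z : ℍ) : D F z = F' z := congrFun h.2 z

lemma congr (h : HasNormalizedDeriv F₁ F₁') (hF : ∀ z, F₂ z = F₁ z) (hF' : ∀ z, F₂' z = F₁' z) :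
    HasNormalizedDeriv F₂ F₂' := by
  obtain rfl : F₂ = F₁ := funext hF
  obtain rfl : F₂' = F₁' := funext hF'
  exact h

lemma const_mul (a : ℂ) (h : HasNormalizedDeriv F F') :
    HasNormalizedDeriv (fun z => a * F z) (fun z => a * F' z) := by
  obtain ⟨h, rfl⟩ := h
  exact ⟨h.const_smul a, normalizedDerivOfComplex_smul a F h⟩

lemma add (h₁ : HasNormalizedDeriv F₁ F₁') (h₂ : HasNormalizedDeriv F₂ F₂') :
    HasNormalizedDeriv (fun z => F₁ z + F₂ z) (fun z => F₁' z + F₂' z) := by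
  obtain ⟨h₁, rfl⟩ := h₁
  obtain ⟨h₂, rfl⟩ := h₂
  exact ⟨h₁.add h₂, normalizedDerivOfComplex_add F₁ F₂ h₁ h₂⟩

lemma sub (h₁ : HasNormalizedDeriv F₁ F₁') (h₂ : HasNormalizedDeriv F₂ F₂') :
    HasNormalizedDeriv (fun z => F₁ z - F₂ z) (fun z => F₁' z - F₂' z) := by
  obtain ⟨h₁, rfl⟩ := h₁
  obtain ⟨h₂, rfl⟩ := h₂
  exact ⟨h₁.sub h₂, normalizedDerivOfComplex_sub F₁ F₂ h₁ h₂⟩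

lemma mul (h₁ : HasNormalizedDeriv F₁ F₁') (h₂ : HasNormalizedDeriv F₂ F₂') :
    HasNormalizedDeriv (fun z => F₁ z * F₂ z) (fun z => F₁' z * F₂ z + F₁ z * F₂' z) := by
  obtain ⟨h₁, rfl⟩ := h₁
  obtain ⟨h₂, rfl⟩ := h₂
  exact ⟨h₁.mul h₂, normalizedDerivOfComplex_mul F₁ F₂ h₁ h₂⟩

/-- The exponent `n + 1` avoids natural subtraction in the derivative; thus `pow 1` is the rule for
squares. -/
lemma pow (h : HasNormalizedDeriv F F') (n : ℕ) :
    HasNormalizedDeriv (fun z => F z ^ (n + 1)) (fun z => (n + 1) * F z ^ n * F' z) := by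
  induction n with
  | zero => exact h.congr (by simp) (by simp)
  | succ n ih =>
    exact (ih.mul h).congr (fun z => by ring) (fun z => by push_cast; ring)

end HasNormalizedDeriv

end QuasimodularRecurrence

namespace QuasimodularRecurrence

/-! ### Modular forms of level one -/

/-- `F` underlies a holomorphic modular form of weight `k` for `SL(2, ℤ)`. -/
def IsModular (k : ℤ) (F : ℍ → ℂ) : Prop := ∃ M : ModularForm 𝒮ℒ k, ⇑M = F

namespace IsModular

variable {k l : ℤ} {F F₁ F₂ : ℍ → ℂ}

/-- In level one all cusps are equivalent, so by invariance boundedness at `i∞` suffices. -/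
lemma of_slash_eq (hF : MDiff F) (hs : ∀ γ : SL(2, ℤ), F ∣[k] γ = F)
    (hb : IsBoundedAtImInfty F) : IsModular k F :=
  ⟨{ toFun := F
     slash_action_eq' := fun _ ⟨γ, hγ⟩ => hγ ▸ hs γ
     holo' := hF
     bdd_at_cusps' := fun {c} hc => by
      rw [Subgroup.IsArithmetic.isCusp_iff_isCusp_SL2Z] at hc
      rw [OnePoint.isBoundedAt_iff_forall_SL2Z hc]
      intro γ _
      rw [hs γ]
      exact hb }, rfl⟩

/-- Keeping the equality of weights as a hypothesis confines all transport between the types of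
modular forms of equal weight to this one place. -/
lemma congr (h : IsModular k F₁) (hF : ∀ z, F₂ z = F₁ z) (hk : l = k) : IsModular l F₂ := by
  obtain rfl : F₂ = F₁ := funext hF
  exact hk ▸ h

lemma mul (h₁ : IsModular k F₁) (h₂ : IsModular l F₂) :
    IsModular (k + l) (fun z => F₁ z * F₂ z) := by
  obtain ⟨M₁, rfl⟩ := h₁
  obtain ⟨M₂, rfl⟩ := h₂
  exact ⟨M₁.mul M₂, rfl⟩

lemma add (h₁ : IsModular k F₁) (h₂ : IsModular k F₂) : IsModular k (fun z => F₁ z + F₂ z) := by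
  obtain ⟨M₁, rfl⟩ := h₁
  obtain ⟨M₂, rfl⟩ := h₂
  exact ⟨M₁ + M₂, rfl⟩

lemma const_mul (a : ℂ) (h : IsModular k F) : IsModular k (fun z => a * F z) := by
  obtain ⟨M, rfl⟩ := h
  exact ⟨a • M, rfl⟩

lemma sub (h₁ : IsModular k F₁) (h₂ : IsModular k F₂) : IsModular k (fun z => F₁ z - F₂ z) :=
  (h₁.add (h₂.const_mul (-1))).congr (fun z => by ring) rfl

lemma mdifferentiable (h : IsModular k F) : MDiff F := by
  obtain ⟨M, rfl⟩ := h
  exact ModularFormClass.holo M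

lemma slash_eq (h : IsModular k F) (γ : SL(2, ℤ)) : F ∣[k] γ = F := by
  obtain ⟨M, rfl⟩ := h
  exact SlashInvariantForm.slash_action_eqn M _ ⟨γ, rfl⟩

lemma isBoundedAtImInfty (h : IsModular k F) : IsBoundedAtImInfty F := by
  obtain ⟨M, rfl⟩ := h
  exact ModularFormClass.bdd_at_infty M

lemma periodic (h : IsModular k F) : Function.Periodic (F ∘ ofComplex) 1 := by
  obtain ⟨M, rfl⟩ := h
  simpa using SlashInvariantFormClass.periodic_comp_ofComplex M one_mem_strictPeriods_SL

lemma hasLeadingTerm (h : IsModular k F) : HasLeadingTerm F 0 (cuspFunction 1 F 0) :=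
  .of_periodic h.periodic h.mdifferentiable h.isBoundedAtImInfty

/-- A modular form of weight less than `12` that vanishes at the cusp is zero. -/
lemma eq_zero_of_weight_lt_twelve (h : IsModular k F) (hk : k < 12)
    (h0 : HasLeadingTerm F 0 0) : F = 0 := by
  have hc := h.hasLeadingTerm.unique h0
  obtain ⟨M, rfl⟩ := h
  have hcusp : (qExpansion 1 M).coeff 0 = 0 := by
    simpa [qExpansion_coeff] using hc
  have := rank_zero_iff_forall_zero.mp (CuspForm.rank_eq_zero_of_weight_lt_twelve hk)
    (toCuspForm M hcusp)
  exact congrArg DFunLike.coe this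

end IsModular

lemma isModular_E₄ : IsModular 4 E₄ := ⟨E₄, rfl⟩

lemma isModular_E₆ : IsModular 6 E₆ := ⟨E₆, rfl⟩

lemma isModular_discriminant : IsModular 12 discriminant :=
  .of_slash_eq CuspForm.discriminant.holo'
    (SlashInvariantForm.slash_action_generators_SL2Z discriminant_S_invariant
      discriminant_T_invariant)
    (Filter.Tendsto.isBigO_one ℝ discriminant_isZeroAtImInfty)

/-! ### Leading terms of Eisenstein series -/

lemma hasLeadingTerm_of_qExpansion {k : ℤ} (M : ModularForm 𝒮ℒ k) {c : ℂ}
    (hc : (qExpansion 1 M).coeff 0 = c) : HasLeadingTerm M 0 c := by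
  have h : IsModular k M := ⟨M, rfl⟩
  obtain rfl : cuspFunction 1 M 0 = c := by simpa [qExpansion_coeff] using hc
  exact h.hasLeadingTerm

lemma hasLeadingTerm_E₄ : HasLeadingTerm E₄ 0 1 :=
  hasLeadingTerm_of_qExpansion _ (E_qExpansion_coeff_zero _ ⟨2, rfl⟩)

lemma hasLeadingTerm_E₆ : HasLeadingTerm E₆ 0 1 :=
  hasLeadingTerm_of_qExpansion _ (E_qExpansion_coeff_zero _ ⟨3, rfl⟩)

/-- Subtracting the constant term does not change the derivative and leaves a function of order at
least `q`, on which `D` acts as multiplication by `1` to leading order. -/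
lemma hasLeadingTerm_deriv_of_qExpansion {k : ℤ} (M : ModularForm 𝒮ℒ k) {c : ℂ}
    (hc : (qExpansion 1 M).coeff 1 = c) : HasLeadingTerm (D M) 1 c := by
  have h : IsModular k M := ⟨M, rfl⟩
  have hd : deriv (cuspFunction 1 M) 0 = c := by simpa [qExpansion_coeff] using hc
  have h1 := HasLeadingTerm.sub_const (F := M)
    (ModularFormClass.analyticAt_cuspFunction_zero M one_pos one_mem_strictPeriods_SL)
    (fun z => (SlashInvariantFormClass.eq_cuspFunction M z one_mem_strictPeriods_SL
      one_ne_zero).symm)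
  rw [hd] at h1
  have h2 := h1.deriv
  have hD : D (fun z : ℍ => M z - cuspFunction 1 M 0) = D M := by
    have := normalizedDerivOfComplex_sub M (fun _ => cuspFunction 1 M 0) h.mdifferentiable
      mdifferentiable_const
    rw [normalizedDerivOfComplex_const, sub_zero] at this
    exact this
  rw [hD] at h2
  simpa using h2

lemma hasLeadingTerm_deriv_E₄ : HasLeadingTerm (D E₄) 1 240 :=
  hasLeadingTerm_deriv_of_qExpansion _ E₄_qExpansion_coeff_one

lemma hasLeadingTerm_deriv_E₆ : HasLeadingTerm (D E₆) 1 (-504) :=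
  hasLeadingTerm_deriv_of_qExpansion _ E₆_qExpansion_coeff_one

lemma E2_vadd_one (z : ℍ) : E2 ((1 : ℝ) +ᵥ z) = E2 z := by
  have h : Complex.exp (2 * Real.pi * Complex.I * (((1 : ℝ) +ᵥ z : ℍ) : ℂ)) =
      Complex.exp (2 * Real.pi * Complex.I * z) := by
    rw [coe_vadd, mul_add, Complex.exp_add]
    simp
  rw [E2_eq_tsum_cexp, E2_eq_tsum_cexp, h]

lemma periodic_E2 : Function.Periodic (E2 ∘ ofComplex) 1 := by
  intro w
  by_cases hw : 0 < w.im
  · have hw' : 0 < (w + 1).im := by simpa using hw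
    rw [Function.comp_apply, Function.comp_apply, ofComplex_apply_of_im_pos hw,
      ofComplex_apply_of_im_pos hw', ← E2_vadd_one ⟨w, hw⟩]
    congr 1
    ext
    simp [add_comm]
  -- Outside the upper half-plane `ofComplex` takes one default value, so periodicity is trivial
  -- there.
  · have hw' : (w + 1).im ≤ 0 := by simpa using hw
    rw [Function.comp_apply, Function.comp_apply, ofComplex_apply_of_im_nonpos hw',
      ofComplex_apply_of_im_nonpos (not_lt.mp hw)]

lemma cuspFunction_E2_zero : cuspFunction 1 E2 0 = 1 := by
  have han : AnalyticAt ℂ (cuspFunction 1 E2) 0 :=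
    analyticAt_cuspFunction_zero one_pos (by simpa using periodic_E2) E2_mdifferentiable
      isBoundedAtImInfty_E2
  have hs : ∀ τ : ℍ, HasSum (fun m : ℕ =>
      (if m = 0 then 1 else -24 * ArithmeticFunction.sigma 1 m : ℂ) •
        Function.Periodic.qParam 1 (τ : ℂ) ^ m) (E2 τ) := by
    intro τ
    have := hasSum_qExpansion_E2 τ
    simpa only [Function.Periodic.qParam, Complex.ofReal_one, div_one] using this
  have hc := (hasFPowerSeriesOnBall_cuspFunction one_pos han hs).coeff_zero (fun _ => 0)
  rw [← hc]
  simp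

lemma hasLeadingTerm_E2 : HasLeadingTerm E2 0 1 := by
  have h := HasLeadingTerm.of_periodic periodic_E2 E2_mdifferentiable isBoundedAtImInfty_E2
  rwa [cuspFunction_E2_zero] at h

/-- Only vanishing at the cusp is used later; the value of the coefficient plays no role. -/
lemma hasLeadingTerm_discriminant : ∃ c, HasLeadingTerm discriminant 1 c := by
  have h := HasLeadingTerm.sub_const (F := discriminant)
    (analyticAt_cuspFunction_zero one_pos (by simpa using isModular_discriminant.periodic)
      isModular_discriminant.mdifferentiable isModular_discriminant.isBoundedAtImInfty)
    (fun z => (eq_cuspFunction z one_ne_zero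
      (by simpa using isModular_discriminant.periodic)).symm)
  have h0 : cuspFunction 1 discriminant 0 = 0 :=
    tendsto_nhds_unique isModular_discriminant.hasLeadingTerm.tendsto_zero_exponent
      discriminant_isZeroAtImInfty
  exact ⟨_, h.congr fun z => by rw [h0, sub_zero]⟩

/-! ### Ramanujan's identities -/

/-- This is the source of Ramanujan's identities for `E₄` and `E₆`: the difference of the two sides
becomes a modular form of weight `6` or `8` with zero constant term, hence is zero. -/
lemma isModular_serreDerivative {k : ℤ} {F : ℍ → ℂ} (h : IsModular k F) :
    IsModular (k + 2) (serreDerivative k F) := by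
  refine .of_slash_eq (serreDerivative_mdifferentiable _ h.mdifferentiable)
    (fun γ => serreDerivative_slash_invariant h.mdifferentiable (h.slash_eq γ)) ?_
  have := h.hasLeadingTerm.deriv.sub ((hasLeadingTerm_E2.mul h.hasLeadingTerm).const_mul (k * 12⁻¹))
  exact (this.congr fun z => by rw [serreDerivative_apply]; ring).isBoundedAtImInfty

theorem hasNormalizedDeriv_E₄ :
    HasNormalizedDeriv E₄ (fun z => (E2 z * E₄ z - E₆ z) / 3) := by
  refine ⟨isModular_E₄.mdifferentiable, funext fun z => ?_⟩
  have h1 := (isModular_serreDerivative isModular_E₄).add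
    ((isModular_E₆.const_mul (1 / 3)).congr (fun _ => rfl) (by norm_num : (4 + 2 : ℤ) = 6))
  have h2 := (hasLeadingTerm_E₄.deriv.sub
    ((hasLeadingTerm_E2.mul hasLeadingTerm_E₄).const_mul ((4 : ℤ) * 12⁻¹))).add
    (hasLeadingTerm_E₆.const_mul (1 / 3))
  have h3 := h1.eq_zero_of_weight_lt_twelve (by norm_num) (by
    convert h2.congr (F₂ := fun z => serreDerivative (4 : ℤ) E₄ z + 1 / 3 * E₆ z)
      (fun z => by rw [serreDerivative_apply]; ring) using 1
    norm_num)
  have h4 := congrFun h3 z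
  simp only [serreDerivative_apply, Pi.zero_apply] at h4
  push_cast at h4
  linear_combination h4

theorem hasNormalizedDeriv_E₆ :
    HasNormalizedDeriv E₆ (fun z => (E2 z * E₆ z - E₄ z ^ 2) / 2) := by
  refine ⟨isModular_E₆.mdifferentiable, funext fun z => ?_⟩
  have h1 := (isModular_serreDerivative isModular_E₆).add
    (((isModular_E₄.mul isModular_E₄).const_mul (1 / 2)).congr (fun _ => rfl)
      (by norm_num : (6 + 2 : ℤ) = 4 + 4))
  have h2 := (hasLeadingTerm_E₆.deriv.sub
    ((hasLeadingTerm_E2.mul hasLeadingTerm_E₆).const_mul ((6 : ℤ) * 12⁻¹))).add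
    ((hasLeadingTerm_E₄.mul hasLeadingTerm_E₄).const_mul (1 / 2))
  have h3 := h1.eq_zero_of_weight_lt_twelve (by norm_num) (by
    convert h2.congr (F₂ := fun z => serreDerivative (6 : ℤ) E₆ z + 1 / 2 * (E₄ z * E₄ z))
      (fun z => by rw [serreDerivative_apply]; ring) using 1
    norm_num)
  have h4 := congrFun h3 z
  simp only [serreDerivative_apply, Pi.zero_apply] at h4
  push_cast at h4
  linear_combination h4

/-- The inhomogeneous transformation law of `E₂`. -/
lemma E2_slash_apply (γ : SL(2, ℤ)) (z : ℍ) :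
    (E2 ∣[(2 : ℤ)] γ) z =
      E2 z + 12 * (2 * Real.pi * Complex.I)⁻¹ * (γ 1 0 / denom γ z) := by
  rw [E2_slash_action, Pi.sub_apply, Pi.smul_apply, D2, riemannZeta_two, smul_eq_mul]
  have hpi : (Real.pi : ℂ) ≠ 0 := by exact_mod_cast Real.pi_ne_zero
  have := denom_ne_zero γ z
  field_simp
  linear_combination (-12 * (γ 1 0 : ℂ)) * Complex.I_sq

/-- `E2` is not modular, so its Serre-type derivative needs a direct check: the anomalies of `D E2`
and `E2 ^ 2 / 12` under the slash action cancel. -/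
lemma isModular_deriv_E2_sub : IsModular 4 (fun z => D E2 z - E2 z ^ 2 / 12) := by
  have hm := E2_mdifferentiable
  have hsub := (HasNormalizedDeriv.of_mdifferentiable
    (normalizedDerivOfComplex_mdifferentiable hm)).sub
    (((HasNormalizedDeriv.of_mdifferentiable hm).pow 1).const_mul (1 / 12))
  refine .of_slash_eq (hsub.congr (fun z => by ring) (fun _ => rfl)).1 (fun γ => ?_) ?_
  · set e : ℂ := (2 * Real.pi * Complex.I)⁻¹ with he
    set u : ℍ → ℂ := fun z => γ 1 0 / denom γ z with hu
    have hinv : HasNormalizedDeriv (fun z => (denom γ z)⁻¹)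
        (fun z => - (e * u z * (denom γ z)⁻¹)) := by
      refine ⟨mdifferentiable_inv_denom _, ?_⟩
      -- The constant function `1`, slashed in weight `1`, is the inverse denominator, so the
      -- general rule for differentiating a slash yields the derivative of that inverse.
      have h := normalizedDerivOfComplex_SL_slash (k := 1) (F := fun _ => 1)
        mdifferentiable_const (γ := γ)
      have h1 : ((fun _ => 1 : ℍ → ℂ) ∣[(1 : ℤ)] γ) = fun z : ℍ => (denom γ z)⁻¹ := by
        ext z; simp [SL_slash_apply]
      rw [h1, normalizedDerivOfComplex_const, SlashAction.zero_slash] at h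
      rw [h]
      ext z
      simp [hu, he]
    have hE : (E2 ∣[(2 : ℤ)] γ) = fun z => E2 z + 12 * e * γ 1 0 * (denom γ z)⁻¹ := by
      ext z
      rw [E2_slash_apply]
      ring
    have hd := (HasNormalizedDeriv.of_mdifferentiable hm).add (hinv.const_mul (12 * e * γ 1 0))
    have hs := normalizedDerivOfComplex_SL_slash (k := 2) hm (γ := γ)
    rw [hE, hd.2] at hs
    simp only [← he] at hs
    clear_value e
    ext z
    have hsz := congrFun hs z
    have hEz := congrFun hE z
    simp only [Pi.sub_apply] at hsz
    have hsq := congrFun (mul_slash_SL2 2 2 γ E2 E2) z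
    rw [Pi.mul_apply, hEz] at hsq
    rw [SL_slash_apply] at hsq hsz ⊢
    simp only [Pi.mul_apply] at hsq
    norm_num at hsz hsq ⊢
    simp only [hu] at hsz
    linear_combination hsz.symm - hsq / 12
  · have h := hasLeadingTerm_E2
    exact ((h.deriv.sub ((h.pow 2).const_mul (1 / 12))).congr
      fun z => by ring).isBoundedAtImInfty

theorem hasNormalizedDeriv_E2 :
    HasNormalizedDeriv E2 (fun z => (E2 z ^ 2 - E₄ z) / 12) := by
  refine ⟨E2_mdifferentiable, funext fun z => ?_⟩
  have h1 := isModular_deriv_E2_sub.add (isModular_E₄.const_mul (1 / 12))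
  have h2 := (hasLeadingTerm_E2.deriv.sub ((hasLeadingTerm_E2.pow 2).const_mul (1 / 12))).add
    (hasLeadingTerm_E₄.const_mul (1 / 12))
  have h3 := h1.eq_zero_of_weight_lt_twelve (by norm_num) (by
    convert h2.congr (F₂ := fun z => D E2 z - E2 z ^ 2 / 12 + 1 / 12 * E₄ z)
      (fun z => by ring) using 1
    norm_num)
  have h4 := congrFun h3 z
  simp only [Pi.zero_apply] at h4
  linear_combination h4

theorem hasNormalizedDeriv_discriminant :
    HasNormalizedDeriv discriminant (fun z => E2 z * discriminant z) :=
  (((hasNormalizedDeriv_E₄.pow 2).sub (hasNormalizedDeriv_E₆.pow 1)).const_mul (1 / 1728)).congr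
    (fun z => by rw [discriminant_eq_E₄_cube_sub_E₆_sq]; ring)
    (fun z => by rw [discriminant_eq_E₄_cube_sub_E₆_sq]; push_cast; ring)

end QuasimodularRecurrence

namespace QuasimodularRecurrence

/-! ### Coefficients of the recurrence and of the contiguity relations -/

/-- The denominator of the recurrence. -/
def recDen (w : ℂ) : ℂ := 16000 * (w - 3) * (w - 4) * (w - 5) * (w - 9) * (w - 11) * (w - 16)

/-- The coefficient of `E₄ f_w` in the recurrence. -/
def recA (w : ℂ) : ℂ := 200 * (w - 9) * (w - 10) * (w ^ 2 - 21 * w + 92)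

/-- The negated coefficient of `E₄² f_{w-4}` in the recurrence. -/
noncomputable def recB (w : ℂ) : ℂ := 5 / 8 * (w - 10) * (w - 14)

/-- The negated coefficient of `E₄ f_{w+4}` in the first order contiguity relation. -/
def contA (w : ℂ) : ℂ := 100 * w ^ 3 - 1620 * w ^ 2 + 7520 * w - 9600

/-- The coefficient of `f_{w+8}` in the first order contiguity relation. -/
def contB (w : ℂ) : ℂ := 9600 * (w + 1) * w * (w - 1) * (w - 5) * (w - 12)

/-- The coefficient of `f_{w+4}` in the second order contiguity relation. -/
noncomputable def contC (w : ℂ) : ℂ := -(10 / 3) * (w - 3) * (w - 4) * (w - 5) * (w - 16)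

/-- The first order contiguity relation. Here `P`, `Q`, `R` are the values of `E₂`, `E₄`, `E₆`,
`c`, `d`, `e` those of `f_w`, `f_{w+4}`, `f_{w+8}`, and `c'` that of `f_w'`. -/
def FirstOrderRel (w P Q R c d e c' : ℂ) : Prop :=
  R * (c' - (w - 2) / 12 * (P * c)) =
    (w - 8) / 6 * (Q ^ 2 * c) - contA w * (Q * d) + contB w * e

/-- The second order contiguity relation. -/
def SecondOrderRel (w P Q c d c' c'' : ℂ) : Prop :=
  c'' - (w - 1) / 6 * (P * c') + ((w - 2) * (w - 1) / 144 * P ^ 2 + (w - 2) / 144 * Q) * c =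
    (w - 8) * (w - 9) / 36 * (Q * c) + contC w * d

/-- The recurrence cleared of denominators; `a`, `b`, `c`, `d` are the values of `f_{w-8}`,
`f_{w-4}`, `f_w`, `f_{w+4}` and `Δ` is the value of the discriminant. -/
def RecurrenceRel (w Q Δ a b c d : ℂ) : Prop :=
  recDen w * d = recA w * (Q * c) - recB w * (Q ^ 2 * b) + Δ * a

variable {w P Q R Δ a b c d e g a' b' c' d' a'' b'' c'' d'' c''' : ℂ}

/-- Multiplying the differentiated recurrence by `R` and replacing `R a'`, `R b'`, `R c'` by the
three known relations leaves an identity modulo the recurrences and `R² = Q³ - 1728 Δ`. -/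
lemma FirstOrderRel.step (hN : recDen w ≠ 0) (hΔ : 1728 * Δ = Q ^ 3 - R ^ 2)
    (h1 : RecurrenceRel w Q Δ a b c d) (h2 : RecurrenceRel (w + 4) Q Δ b c d e)
    (h3 : RecurrenceRel (w + 8) Q Δ c d e g)
    (h1' : recDen w * d' = recA w * ((P * Q - R) / 3 * c + Q * c')
      - recB w * (2 * Q * ((P * Q - R) / 3) * b + Q ^ 2 * b') + (P * Δ * a + Δ * a'))
    (ha : FirstOrderRel (w - 8) P Q R a b c a') (hb : FirstOrderRel (w - 4) P Q R b c d b')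
    (hc : FirstOrderRel w P Q R c d e c') :
    FirstOrderRel (w + 4) P Q R d e g d' := by
  apply mul_left_cancel₀ hN
  unfold FirstOrderRel RecurrenceRel at *
  simp only [recDen, recA, recB, contA, contB] at *
  -- In the coefficient of `h1`, `(w + 2) / 12` is the Serre factor at index `w + 4` and `(w - 16) /
  -- 6` comes from the relation at `w - 8`. The coefficient of `h2` is `contA (w - 8) + 720 (w - 10)
  -- (w - 14)`, which matches the `Δ Q b` terms. The coefficient of `h3` is `recDen w * contB (w +
  -- 4) / recDen (w + 8)` up to sign and eliminates `g`.
  linear_combination (exp := 1) R * h1'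
    + 200 * (w - 9) * (w - 10) * (w ^ 2 - 21 * w + 92) * Q * hc
    - 5 / 8 * (w - 10) * (w - 14) * Q ^ 2 * hb + Δ * ha
    - (R * P * (w + 2) / 12 + (w - 16) / 6 * Q ^ 2) * h1
    + Q * (100 * w ^ 3 - 3300 * w ^ 2 + 35360 * w - 123840) * h2
    - 9600 * (w - 4) * (w - 5) * (w - 9) * (w - 11) * (w - 16) * h3
    - (200 * (w - 9) * (w - 10) * (w ^ 2 - 21 * w + 92) / 3 * c
      - 5 / 12 * (w - 10) * (w - 14) * Q * b) * hΔ

/-- The second derivative of the recurrence contains cross terms `Q' b'` and `Q' c'`. By `Q' = (P Q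
- R) / 3` these produce `R b'` and `R c'`, which is why the first order relations are needed as
well. -/
lemma SecondOrderRel.step (hN : recDen w ≠ 0) (hΔ : 1728 * Δ = Q ^ 3 - R ^ 2)
    (h1 : RecurrenceRel w Q Δ a b c d) (h2 : RecurrenceRel (w + 4) Q Δ b c d e)
    (h1' : recDen w * d' = recA w * ((P * Q - R) / 3 * c + Q * c')
      - recB w * (2 * Q * ((P * Q - R) / 3) * b + Q ^ 2 * b') + (P * Δ * a + Δ * a'))
    (h1'' : recDen w * d'' =
      recA w * ((5 * P ^ 2 * Q + 5 * Q ^ 2 - 10 * P * R) / 36 * c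
        + 2 * ((P * Q - R) / 3) * c' + Q * c'')
      - recB w * ((2 * ((P * Q - R) / 3) ^ 2
          + 2 * Q * ((5 * P ^ 2 * Q + 5 * Q ^ 2 - 10 * P * R) / 36)) * b
        + 4 * Q * ((P * Q - R) / 3) * b' + Q ^ 2 * b'')
      + ((13 * P ^ 2 - Q) / 12 * Δ * a + 2 * P * Δ * a' + Δ * a''))
    (hb : FirstOrderRel (w - 4) P Q R b c d b') (hc : FirstOrderRel w P Q R c d e c')
    (ka : SecondOrderRel (w - 8) P Q a b a' a'') (kb : SecondOrderRel (w - 4) P Q b c b' b'')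
    (kc : SecondOrderRel w P Q c d c' c'') :
    SecondOrderRel (w + 4) P Q d e d' d'' := by
  apply mul_left_cancel₀ hN
  unfold FirstOrderRel RecurrenceRel SecondOrderRel at *
  simp only [recDen, recA, recB, contA, contB, contC] at *
  linear_combination (exp := 1) h1''
    + 200 * (w - 9) * (w - 10) * (w ^ 2 - 21 * w + 92) * Q * kc
    - 5 / 8 * (w - 10) * (w - 14) * Q ^ 2 * kb + Δ * ka
    - (w + 3) / 6 * P * h1'
    + ((w + 3) * (w + 2) / 144 * P ^ 2 + (w + 2) / 144 * Q - (w - 16) * (w - 17) / 36 * Q) * h1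
    - 2 / 3 * (200 * (w - 9) * (w - 10) * (w ^ 2 - 21 * w + 92)) * hc
    + 4 / 3 * (5 / 8 * (w - 10) * (w - 14)) * Q * hb
    + 10 / 3 * (w - 9) * (w ^ 3 - 51 * w ^ 2 + 764 * w - 3456) * h2
    - 5 / 36 * (w - 10) * (w - 14) * b * hΔ

/-- The contiguity relations imply the third order differential equation. The variables stand for
`f_w`, `f_{w+4}`, `f_{w+8}`, `f_{w+12}` and derivatives of the first two. -/
lemma ode_of_rel (hΔ : 1728 * Δ = Q ^ 3 - R ^ 2)
    (hc : FirstOrderRel w P Q R c d e c') (hd : FirstOrderRel (w + 4) P Q R d e g d')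
    (kc : SecondOrderRel w P Q c d c' c'') (hr : RecurrenceRel (w + 8) Q Δ c d e g)
    (kc' : c''' - (w - 1) / 6 * ((P ^ 2 - Q) / 12 * c' + P * c'')
      + ((w - 2) * (w - 1) / 144 * (2 * P * ((P ^ 2 - Q) / 12))
        + (w - 2) / 144 * ((P * Q - R) / 3)) * c
      + ((w - 2) * (w - 1) / 144 * P ^ 2 + (w - 2) / 144 * Q) * c' =
      (w - 8) * (w - 9) / 36 * ((P * Q - R) / 3 * c + Q * c') + contC w * d') :
    R * c''' - ((w - 2) / 4 * Q ^ 2 + w / 2 * ((P * R - Q ^ 2) / 2)) * c''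
      + ((w - 6) / 4 * (Q * R) + (w - 1) * (w - 2) / 8 * (Q * ((P * Q - R) / 3))
        + w * (w - 1) / 14 * ((7 * P ^ 2 * R - 14 * P * Q ^ 2 + 7 * Q * R) / 24)) * c'
      - ((w - 2) * (w - 6) / 24 * (Q * ((P * R - Q ^ 2) / 2))
        + 5 * (w - 8) * (w - 9) * (w - 10) / 384 * ((P * Q - R) / 3) ^ 2
        + (w ^ 3 + 105 * w ^ 2 - 1162 * w + 3576) / 480
          * (Q * ((5 * P ^ 2 * Q + 5 * Q ^ 2 - 10 * P * R) / 36))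
        + w * (w - 1) * (w - 2) / 336
          * ((14 * P ^ 3 * R - 42 * P ^ 2 * Q ^ 2 + 42 * P * Q * R - 7 * Q ^ 3 - 7 * R ^ 2) / 72))
        * c = 0 := by
  unfold FirstOrderRel RecurrenceRel SecondOrderRel at *
  simp only [recDen, recA, recB, contA, contB, contC] at *
  -- `R` times the differentiated second order relation contains `contC w * R * d'`. The relation
  -- `hd` removes `d'`, then `hr` removes `g`, and multiples of `hc` and `kc` remove `e` and `d`.
  linear_combination (exp := 1) R * kc' - (w + 2) / 12 * P * R * kc + Q ^ 2 / 2 * kc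
    - 10 / 3 * (w - 3) * (w - 4) * (w - 5) * (w - 16) * hd
    - 2 * (w - 4) * (w - 5) * (w - 16) * hr
    + (w - 4) * (w - 16) / 144 * Q * hc
    - (w - 4) * (w - 5) * (w - 16) / 864 * c * hΔ

end QuasimodularRecurrence

namespace QuasimodularRecurrence

/-! ### Higher derivatives of Eisenstein series -/

lemma hasNormalizedDeriv_deriv_E₄ : HasNormalizedDeriv (D E₄)
    (fun z => (5 * E2 z ^ 2 * E₄ z + 5 * E₄ z ^ 2 - 10 * E2 z * E₆ z) / 36) := by
  rw [hasNormalizedDeriv_E₄.2]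
  exact (((hasNormalizedDeriv_E2.mul hasNormalizedDeriv_E₄).sub
    hasNormalizedDeriv_E₆).const_mul (1 / 3)).congr (fun z => by ring) (fun z => by ring)

lemma hasNormalizedDeriv_deriv_E₆ : HasNormalizedDeriv (D E₆)
    (fun z => (7 * E2 z ^ 2 * E₆ z - 14 * E2 z * E₄ z ^ 2 + 7 * E₄ z * E₆ z) / 24) := by
  rw [hasNormalizedDeriv_E₆.2]
  exact (((hasNormalizedDeriv_E2.mul hasNormalizedDeriv_E₆).sub
    (hasNormalizedDeriv_E₄.pow 1)).const_mul (1 / 2)).congr (fun z => by ring)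
    (fun z => by push_cast; ring)

lemma hasNormalizedDeriv_deriv_deriv_E₄ : HasNormalizedDeriv (D (D E₄))
    (fun z => (5 * E2 z ^ 3 * E₄ z - 15 * E2 z ^ 2 * E₆ z + 15 * E2 z * E₄ z ^ 2
      - 5 * E₄ z * E₆ z) / 72) := by
  rw [hasNormalizedDeriv_deriv_E₄.2]
  exact (((((hasNormalizedDeriv_E2.pow 1).mul hasNormalizedDeriv_E₄).const_mul 5).add
    ((hasNormalizedDeriv_E₄.pow 1).const_mul 5)).sub
    ((hasNormalizedDeriv_E2.mul hasNormalizedDeriv_E₆).const_mul 10)).const_mul (1 / 36) |>.congr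
    (fun z => by ring) (fun z => by push_cast; ring)

lemma hasNormalizedDeriv_deriv_deriv_E₆ : HasNormalizedDeriv (D (D E₆))
    (fun z => (14 * E2 z ^ 3 * E₆ z - 42 * E2 z ^ 2 * E₄ z ^ 2 + 42 * E2 z * E₄ z * E₆ z
      - 7 * E₄ z ^ 3 - 7 * E₆ z ^ 2) / 72) := by
  rw [hasNormalizedDeriv_deriv_E₆.2]
  exact (((((hasNormalizedDeriv_E2.pow 1).mul hasNormalizedDeriv_E₆).const_mul 7).sub
    ((hasNormalizedDeriv_E2.mul (hasNormalizedDeriv_E₄.pow 1)).const_mul 14)).add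
    ((hasNormalizedDeriv_E₄.mul hasNormalizedDeriv_E₆).const_mul 7)).const_mul (1 / 24) |>.congr
    (fun z => by ring) (fun z => by push_cast; ring)

/-- The defining relation of the discriminant, in polynomial form. -/
lemma discriminant_relation (z : ℍ) : 1728 * discriminant z = E₄ z ^ 3 - E₆ z ^ 2 := by
  rw [discriminant_eq_E₄_cube_sub_E₆_sq]
  ring

/-! ### Derivatives along the recurrence -/

lemma hasNormalizedDeriv_of_recurrence {w : ℂ} (hN : recDen w ≠ 0)
    {A B C F A' B' C' : ℍ → ℂ}
    (h : ∀ z, RecurrenceRel w (E₄ z) (discriminant z) (A z) (B z) (C z) (F z))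
    (hA : HasNormalizedDeriv A A') (hB : HasNormalizedDeriv B B')
    (hC : HasNormalizedDeriv C C') :
    HasNormalizedDeriv F (fun z => (recDen w)⁻¹ *
      (recA w * ((E2 z * E₄ z - E₆ z) / 3 * C z + E₄ z * C' z)
        - recB w * (2 * E₄ z * ((E2 z * E₄ z - E₆ z) / 3) * B z + E₄ z ^ 2 * B' z)
        + (E2 z * discriminant z * A z + discriminant z * A' z))) :=
  (((((hasNormalizedDeriv_E₄.mul hC).const_mul (recA w)).sub
    (((hasNormalizedDeriv_E₄.pow 1).mul hB).const_mul (recB w))).add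
    (hasNormalizedDeriv_discriminant.mul hA)).const_mul (recDen w)⁻¹).congr
    (fun z => by rw [eq_inv_mul_iff_mul_eq₀ hN]; exact h z)
    (fun z => by push_cast; ring)

lemma hasNormalizedDeriv_deriv_of_recurrence {w : ℂ} (hN : recDen w ≠ 0)
    {A B C F A' B' C' A'' B'' C'' : ℍ → ℂ}
    (h : ∀ z, RecurrenceRel w (E₄ z) (discriminant z) (A z) (B z) (C z) (F z))
    (hA : HasNormalizedDeriv A A') (hB : HasNormalizedDeriv B B')
    (hC : HasNormalizedDeriv C C')
    (hA' : HasNormalizedDeriv A' A'') (hB' : HasNormalizedDeriv B' B'')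
    (hC' : HasNormalizedDeriv C' C'') :
    HasNormalizedDeriv (D F) (fun z => (recDen w)⁻¹ *
      (recA w * ((5 * E2 z ^ 2 * E₄ z + 5 * E₄ z ^ 2 - 10 * E2 z * E₆ z) / 36 * C z
        + 2 * ((E2 z * E₄ z - E₆ z) / 3) * C' z + E₄ z * C'' z)
      - recB w * ((2 * ((E2 z * E₄ z - E₆ z) / 3) ^ 2
          + 2 * E₄ z * ((5 * E2 z ^ 2 * E₄ z + 5 * E₄ z ^ 2 - 10 * E2 z * E₆ z) / 36)) * B z
        + 4 * E₄ z * ((E2 z * E₄ z - E₆ z) / 3) * B' z + E₄ z ^ 2 * B'' z)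
      + ((13 * E2 z ^ 2 - E₄ z) / 12 * discriminant z * A z + 2 * E2 z * discriminant z * A' z
        + discriminant z * A'' z))) := by
  rw [(hasNormalizedDeriv_of_recurrence hN h hA hB hC).2]
  have hQ' := hasNormalizedDeriv_deriv_E₄
  rw [hasNormalizedDeriv_E₄.2] at hQ'
  exact (((((hQ'.mul hC).add (hasNormalizedDeriv_E₄.mul hC')).const_mul (recA w)).sub
    (((((hasNormalizedDeriv_E₄.const_mul 2).mul hQ').mul hB).add
      ((hasNormalizedDeriv_E₄.pow 1).mul hB')).const_mul (recB w))).add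
    (((hasNormalizedDeriv_E2.mul hasNormalizedDeriv_discriminant).mul hA).add
      (hasNormalizedDeriv_discriminant.mul hA'))).const_mul (recDen w)⁻¹ |>.congr
    (fun z => by ring) (fun z => by push_cast; ring)

namespace IsRecurrenceSequence

variable {f : ℕ → ℍ → ℂ}

/-- At the index `w = v + 8 ≥ 18` even the smallest factor, `w - 16`, is at least `2`. -/
lemma recDen_ne_zero {v : ℕ} (hv : 10 ≤ v) : recDen (v + 8) ≠ 0 := by
  obtain ⟨n, rfl⟩ := Nat.exists_eq_add_of_le hv
  have h (k : ℕ) : ((n : ℂ) + (k + 1)) ≠ 0 := by exact_mod_cast (by omega : n + (k + 1) ≠ 0)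
  have e : recDen ((10 + n : ℕ) + 8) = 16000 * ((n : ℂ) + (14 + 1)) * (n + (13 + 1))
      * (n + (12 + 1)) * (n + (8 + 1)) * (n + (6 + 1)) * (n + (1 + 1)) := by
    unfold recDen; push_cast; ring
  rw [e]
  have h14 := h 14; have h13 := h 13; have h12 := h 12
  have h8 := h 8; have h6 := h 6; have h1 := h 1
  push_cast at h14 h13 h12 h8 h6 h1
  simp only [ne_eq, mul_eq_zero, not_or]
  exact ⟨⟨⟨⟨⟨⟨by norm_num, h14⟩, h13⟩, h12⟩, h8⟩, h6⟩, h1⟩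

lemma recurrenceRel (hf : IsRecurrenceSequence f) {v : ℕ} (hv : 10 ≤ v) (hv4 : v % 4 = 2)
    (z : ℍ) : RecurrenceRel (v + 8) (E₄ z) (discriminant z) (f v z) (f (v + 4) z) (f (v + 8) z)
      (f (v + 12) z) := by
  have h := hf.recurrence (v + 8) (by omega) (by omega) z
  rw [show v + 8 + 4 = v + 12 by omega, show v + 8 - 4 = v + 4 by omega,
    show v + 8 - 8 = v by omega] at h
  push_cast at h
  rw [RecurrenceRel, h]
  have hN := recDen_ne_zero hv
  have : recDen (v + 8) * (1 / (16000 * ((v : ℂ) + 8 - 3) * (v + 8 - 4) * (v + 8 - 5)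
      * (v + 8 - 9) * (v + 8 - 11) * (v + 8 - 16))) = 1 := by
    rw [← recDen.eq_def, mul_one_div_cancel hN]
  rw [← mul_assoc, this, one_mul, recA, recB]
  ring

/-- An induction principle for the indices `w ≡ 2 (mod 4)`, `w ≥ 10`. -/
lemma index_induction {p : ℕ → Prop} (h10 : p 10) (h14 : p 14) (h18 : p 18)
    (step : ∀ v, 10 ≤ v → v % 4 = 2 → p v → p (v + 4) → p (v + 8) → p (v + 12)) :
    ∀ w, 10 ≤ w → w % 4 = 2 → p w := by
  intro w
  induction w using Nat.strong_induction_on with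
  | _ w ih =>
    intro hw hw4
    obtain rfl | rfl | rfl | h : w = 10 ∨ w = 14 ∨ w = 18 ∨ 22 ≤ w := by omega
    · exact h10
    · exact h14
    · exact h18
    · obtain ⟨v, rfl⟩ := Nat.exists_eq_add_of_le' (show 12 ≤ w by omega)
      exact step v (by omega) (by omega) (ih _ (by omega) (by omega) (by omega))
        (ih _ (by omega) (by omega) (by omega)) (ih _ (by omega) (by omega) (by omega))

/-- Written through `D E₄`, `D E₆` and `Δ`, each of which vanishes at the cusp, the initial elements
display their vanishing there: one such factor here, two in weights `14` and `18`. -/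
lemma init_ten_eq (hf : IsRecurrenceSequence f) (z : ℍ) :
    f 10 z = 3 * (E₄ z * D E₄ z) - 2 * (E2 z * D E₆ z) := by
  rw [hf.init_ten, hasNormalizedDeriv_E₄.apply, hasNormalizedDeriv_E₆.apply]
  ring

lemma init_fourteen_eq (hf : IsRecurrenceSequence f) (z : ℍ) :
    f 14 z = -(6 / 8400) * (D E₄ z * D E₆ z) := by
  rw [hf.init_fourteen, hasNormalizedDeriv_E₄.apply, hasNormalizedDeriv_E₆.apply]
  ring

lemma init_eighteen_eq (hf : IsRecurrenceSequence f) (z : ℍ) :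
    f 18 z = -(1 / 1995840000) * (72 * (E₄ z * (D E₄ z * D E₆ z))
      + 36288 * (discriminant z * D E₄ z)) := by
  rw [hf.init_eighteen, hasNormalizedDeriv_E₄.apply, hasNormalizedDeriv_E₆.apply,
    discriminant_eq_E₄_cube_sub_E₆_sq]
  ring

lemma mdifferentiable (hf : IsRecurrenceSequence f) :
    ∀ w, 10 ≤ w → w % 4 = 2 → MDiff (f w) := by
  have h4 := hasNormalizedDeriv_deriv_E₄
  have h6 := hasNormalizedDeriv_deriv_E₆
  refine index_induction ?_ ?_ ?_ fun v hv hv4 h0 h1 h2 => ?_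
  · exact (((hasNormalizedDeriv_E₄.mul h4).const_mul 3).sub
      ((hasNormalizedDeriv_E2.mul h6).const_mul 2)).congr hf.init_ten_eq (fun _ => rfl) |>.1
  · exact ((h4.mul h6).const_mul (-(6 / 8400))).congr hf.init_fourteen_eq (fun _ => rfl) |>.1
  · exact ((((hasNormalizedDeriv_E₄.mul (h4.mul h6)).const_mul 72).add
      ((hasNormalizedDeriv_discriminant.mul h4).const_mul 36288)).const_mul
      (-(1 / 1995840000))).congr hf.init_eighteen_eq (fun _ => rfl) |>.1
  · exact (hasNormalizedDeriv_of_recurrence (recDen_ne_zero hv) (hf.recurrenceRel hv hv4)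
      (.of_mdifferentiable h0) (.of_mdifferentiable h1) (.of_mdifferentiable h2)).1

end IsRecurrenceSequence

end QuasimodularRecurrence

namespace QuasimodularRecurrence

/-! ### Second derivatives, and those of `E2` and the discriminant. -/

lemma HasNormalizedDeriv.self {F F' : ℍ → ℂ} (h : HasNormalizedDeriv F F') :
    HasNormalizedDeriv F (D F) := ⟨h.1, rfl⟩

lemma HasNormalizedDeriv.iterate {F F' F'' : ℍ → ℂ} (h : HasNormalizedDeriv F F')
    (h' : HasNormalizedDeriv F' F'') (z : ℍ) : D F z = F' z ∧ D (D F) z = F'' z :=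
  ⟨h.apply z, by rw [h.2, h'.2]⟩

lemma hasNormalizedDeriv_deriv_E2 : HasNormalizedDeriv (D E2)
    (fun z => (E2 z ^ 3 - 3 * E2 z * E₄ z + 2 * E₆ z) / 72) := by
  rw [hasNormalizedDeriv_E2.2]
  exact (((hasNormalizedDeriv_E2.pow 1).sub hasNormalizedDeriv_E₄).const_mul (1 / 12)).congr
    (fun z => by ring) (fun z => by push_cast; ring)

lemma hasNormalizedDeriv_deriv_discriminant : HasNormalizedDeriv (D discriminant)
    (fun z => (13 * E2 z ^ 2 - E₄ z) / 12 * discriminant z) := by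
  rw [hasNormalizedDeriv_discriminant.2]
  exact (hasNormalizedDeriv_E2.mul hasNormalizedDeriv_discriminant).congr
    (fun _ => rfl) (fun z => by ring)

namespace IsRecurrenceSequence

variable {f : ℕ → ℍ → ℂ}

/-! ### Contiguity relations -/

/-- Both contiguity relations hold at the index `w`. -/
def Contiguity (f : ℕ → ℍ → ℂ) (w : ℕ) : Prop :=
  ∀ z : ℍ, FirstOrderRel w (E2 z) (E₄ z) (E₆ z) (f w z) (f (w + 4) z) (f (w + 8) z)
      (D (f w) z) ∧
    SecondOrderRel w (E2 z) (E₄ z) (f w z) (f (w + 4) z) (D (f w) z) (D (D (f w)) z)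

/-- The first order relation at `w` reaches up to `w + 8`, so the base cases `14` and `18` involve
`f 22` and `f 26`. -/
lemma eval_twentytwo (hf : IsRecurrenceSequence f) (z : ℍ) :
    f 22 z = (547200 * (E₄ z * f 18 z) - 20 * (E₄ z ^ 2 * f 14 z)
      + discriminant z * f 10 z) / (16000 * 15 * 14 * 13 * 9 * 7 * 2) := by
  have h := hf.recurrenceRel (v := 10) (by norm_num) (by norm_num) z
  simp only [RecurrenceRel, recDen, recA, recB] at h
  norm_num at h
  rw [eq_div_iff (by norm_num)]
  linear_combination h

lemma eval_twentysix (hf : IsRecurrenceSequence f) (z : ℍ) :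
    f 26 z = (3556800 * (E₄ z * f 22 z) - 60 * (E₄ z ^ 2 * f 18 z)
      + discriminant z * f 14 z) / (16000 * 19 * 18 * 17 * 13 * 11 * 6) := by
  have h := hf.recurrenceRel (v := 14) (by norm_num) (by norm_num) z
  simp only [RecurrenceRel, recDen, recA, recB] at h
  norm_num at h
  rw [eq_div_iff (by norm_num)]
  linear_combination h

/-- After Ramanujan's identities both relations are polynomial identities in `E2`, `E₄`, `E₆`; the
same holds for the other two base cases. -/
lemma contiguity_ten (hf : IsRecurrenceSequence f) : Contiguity f 10 := by
  have hP := hasNormalizedDeriv_E2.self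
  have hP₁ := hasNormalizedDeriv_deriv_E2.self
  have hQ := hasNormalizedDeriv_E₄.self
  have hQ₁ := hasNormalizedDeriv_deriv_E₄.self
  have hQ₂ := hasNormalizedDeriv_deriv_deriv_E₄.self
  have hR₁ := hasNormalizedDeriv_deriv_E₆.self
  have hR₂ := hasNormalizedDeriv_deriv_deriv_E₆.self
  have h := (((hQ.mul hQ₁).const_mul 3).sub ((hP.mul hR₁).const_mul 2)).congr
    hf.init_ten_eq (fun _ => rfl)
  have h' := (((hQ₁.mul hQ₁).add (hQ.mul hQ₂)).const_mul 3).sub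
    (((hP₁.mul hR₁).add (hP.mul hR₂)).const_mul 2)
  intro z
  obtain ⟨e₁, e₂⟩ := h.iterate h' z
  have e14 := hf.init_fourteen z
  have e18 := hf.init_eighteen z
  simp only [hasNormalizedDeriv_E2.apply, hasNormalizedDeriv_deriv_E2.apply,
    hasNormalizedDeriv_E₄.apply, hasNormalizedDeriv_deriv_E₄.apply,
    hasNormalizedDeriv_deriv_deriv_E₄.apply, hasNormalizedDeriv_E₆.apply,
    hasNormalizedDeriv_deriv_E₆.apply, hasNormalizedDeriv_deriv_deriv_E₆.apply] at e₁ e₂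
  simp only [FirstOrderRel, SecondOrderRel, contA, contB, contC, e₁, e₂, Nat.reduceAdd,
    e14, e18, hf.init_ten z]
  constructor <;> · push_cast; ring

lemma contiguity_fourteen (hf : IsRecurrenceSequence f) : Contiguity f 14 := by
  have hQ₁ := hasNormalizedDeriv_deriv_E₄.self
  have hQ₂ := hasNormalizedDeriv_deriv_deriv_E₄.self
  have hR₁ := hasNormalizedDeriv_deriv_E₆.self
  have hR₂ := hasNormalizedDeriv_deriv_deriv_E₆.self
  have h := ((hQ₁.mul hR₁).const_mul (-(6 / 8400))).congr hf.init_fourteen_eq (fun _ => rfl)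
  have h' := ((hQ₂.mul hR₁).add (hQ₁.mul hR₂)).const_mul (-(6 / 8400))
  intro z
  obtain ⟨e₁, e₂⟩ := h.iterate h' z
  have e18 := hf.init_eighteen z
  have e22 := hf.eval_twentytwo z
  simp only [hasNormalizedDeriv_E₄.apply, hasNormalizedDeriv_deriv_E₄.apply,
    hasNormalizedDeriv_deriv_deriv_E₄.apply, hasNormalizedDeriv_E₆.apply,
    hasNormalizedDeriv_deriv_E₆.apply, hasNormalizedDeriv_deriv_deriv_E₆.apply] at e₁ e₂
  simp only [FirstOrderRel, SecondOrderRel, contA, contB, contC, e₁, e₂, Nat.reduceAdd,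
    e22, e18, hf.init_ten z, hf.init_fourteen z, discriminant_eq_E₄_cube_sub_E₆_sq]
  constructor <;> · push_cast; ring

lemma contiguity_eighteen (hf : IsRecurrenceSequence f) : Contiguity f 18 := by
  have hQ := hasNormalizedDeriv_E₄.self
  have hQ₁ := hasNormalizedDeriv_deriv_E₄.self
  have hQ₂ := hasNormalizedDeriv_deriv_deriv_E₄.self
  have hR₁ := hasNormalizedDeriv_deriv_E₆.self
  have hR₂ := hasNormalizedDeriv_deriv_deriv_E₆.self
  have hΔ := hasNormalizedDeriv_discriminant.self
  have hΔ₁ := hasNormalizedDeriv_deriv_discriminant.self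
  have h := ((((hQ.mul (hQ₁.mul hR₁)).const_mul 72).add
      ((hΔ.mul hQ₁).const_mul 36288)).const_mul (-(1 / 1995840000))).congr
      hf.init_eighteen_eq (fun _ => rfl)
  have h' := ((((hQ₁.mul (hQ₁.mul hR₁)).add
      (hQ.mul ((hQ₂.mul hR₁).add (hQ₁.mul hR₂)))).const_mul 72).add
      (((hΔ₁.mul hQ₁).add (hΔ.mul hQ₂)).const_mul 36288)).const_mul (-(1 / 1995840000))
  intro z
  obtain ⟨e₁, e₂⟩ := h.iterate h' z
  have e22 := hf.eval_twentytwo z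
  have e26 := hf.eval_twentysix z
  simp only [hasNormalizedDeriv_E₄.apply, hasNormalizedDeriv_deriv_E₄.apply,
    hasNormalizedDeriv_deriv_deriv_E₄.apply, hasNormalizedDeriv_E₆.apply,
    hasNormalizedDeriv_deriv_E₆.apply, hasNormalizedDeriv_deriv_deriv_E₆.apply,
    hasNormalizedDeriv_discriminant.apply,
    hasNormalizedDeriv_deriv_discriminant.apply] at e₁ e₂
  simp only [FirstOrderRel, SecondOrderRel, contA, contB, contC, e₁, e₂, Nat.reduceAdd,
    e22, e26, hf.init_ten z, hf.init_fourteen z, hf.init_eighteen z,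
    discriminant_eq_E₄_cube_sub_E₆_sq]
  constructor <;> · push_cast; ring

theorem contiguity (hf : IsRecurrenceSequence f) :
    ∀ w, 10 ≤ w → w % 4 = 2 → Contiguity f w := by
  refine index_induction hf.contiguity_ten hf.contiguity_fourteen hf.contiguity_eighteen
    fun v hv hv4 h0 h1 h2 z => ?_
  have hN := recDen_ne_zero hv
  have hd (u : ℕ) (hu : 10 ≤ u) (hu4 : u % 4 = 2) :=
    HasNormalizedDeriv.of_mdifferentiable (hf.mdifferentiable u hu hu4)
  have hd' (u : ℕ) (hu : 10 ≤ u) (hu4 : u % 4 = 2) := HasNormalizedDeriv.of_mdifferentiable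
    (normalizedDerivOfComplex_mdifferentiable (hf.mdifferentiable u hu hu4))
  have r1 := hf.recurrenceRel hv hv4
  have r2 := hf.recurrenceRel (v := v + 4) (by omega) (by omega) z
  have r3 := hf.recurrenceRel (v := v + 8) (by omega) (by omega) z
  have d1 := (hasNormalizedDeriv_of_recurrence hN r1 (hd v hv hv4)
    (hd (v + 4) (by omega) (by omega)) (hd (v + 8) (by omega) (by omega))).apply z
  have d2 := (hasNormalizedDeriv_deriv_of_recurrence hN r1 (hd v hv hv4)
    (hd (v + 4) (by omega) (by omega)) (hd (v + 8) (by omega) (by omega))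
    (hd' v hv hv4) (hd' (v + 4) (by omega) (by omega)) (hd' (v + 8) (by omega) (by omega))).apply z
  rw [eq_inv_mul_iff_mul_eq₀ hN] at d1 d2
  obtain ⟨ha, ka⟩ := h0 z
  obtain ⟨hb, kb⟩ := h1 z
  obtain ⟨hc, kc⟩ := h2 z
  -- The step lemmas are centred at `w = v + 8`, so all indices are rewritten as `w - 8`, `w - 4`,
  -- `w`, `w + 4`.
  have c0 : (v : ℂ) = (v + 8 : ℂ) - 8 := by ring
  have c4 : ((v + 4 : ℕ) : ℂ) = (v + 8 : ℂ) - 4 := by push_cast; ring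
  have c8 : ((v + 8 : ℕ) : ℂ) = (v + 8 : ℂ) := by push_cast; ring
  have c12 : ((v + 12 : ℕ) : ℂ) = (v + 8 : ℂ) + 4 := by push_cast; ring
  have c4' : ((v + 4 : ℕ) : ℂ) + 8 = (v + 8 : ℂ) + 4 := by push_cast; ring
  rw [c4'] at r2
  rw [c8] at r3 hc kc
  rw [c4] at hb kb
  rw [c0] at ha ka
  rw [c12]
  exact ⟨FirstOrderRel.step hN (discriminant_relation z) (r1 z) r2 r3 d1 ha hb hc,
    SecondOrderRel.step hN (discriminant_relation z) (r1 z) r2 d1 d2 hb hc ka kb kc⟩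

/-! ### The differential equation -/

theorem solvesODE (hf : IsRecurrenceSequence f) {w : ℕ} (hw : 10 ≤ w) (hw4 : w % 4 = 2) :
    SolvesODE w (f w) := by
  intro z
  have hm := hf.mdifferentiable w hw hw4
  have hd := HasNormalizedDeriv.of_mdifferentiable hm
  have hd' := HasNormalizedDeriv.of_mdifferentiable (normalizedDerivOfComplex_mdifferentiable hm)
  have hd'' := HasNormalizedDeriv.of_mdifferentiable
    (normalizedDerivOfComplex_mdifferentiable (normalizedDerivOfComplex_mdifferentiable hm))
  have hg := HasNormalizedDeriv.of_mdifferentiable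
    (hf.mdifferentiable (w + 4) (by omega) (by omega))
  have hlhs := (hd''.sub ((hasNormalizedDeriv_E2.mul hd').const_mul (((w : ℂ) - 1) / 6))).add
    ((((hasNormalizedDeriv_E2.pow 1).const_mul (((w : ℂ) - 2) * (w - 1) / 144)).add
      (hasNormalizedDeriv_E₄.const_mul (((w : ℂ) - 2) / 144))).mul hd)
  have hrhs := ((hasNormalizedDeriv_E₄.mul hd).const_mul (((w : ℂ) - 8) * (w - 9) / 36)).add
    (hg.const_mul (contC w))
  -- The second order relation holds at every point, so its two sides are the same function, and
  -- their separately computed derivatives agree.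
  have hlr := hlhs.congr (F₂ := fun z => ((w : ℂ) - 8) * (w - 9) / 36 * (E₄ z * f w z)
      + contC w * f (w + 4) z) (fun z => by
        rw [← (hf.contiguity w hw hw4 z).2]) (fun _ => rfl)
  have key := (hlr.apply z).symm.trans (hrhs.apply z)
  have h1 := (hf.contiguity (w + 4) (by omega) (by omega) z).1
  have c4 : ((w + 4 : ℕ) : ℂ) = w + 4 := by push_cast; ring
  rw [c4] at h1
  have := ode_of_rel (discriminant_relation z) (hf.contiguity w hw hw4 z).1 h1
    (hf.contiguity w hw hw4 z).2 (hf.recurrenceRel hw hw4 z)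
    (c''' := D (D (D (f w))) z) (by push_cast at key; linear_combination key)
  simp only [Function.iterate_succ, Function.iterate_zero, Function.comp_apply, id_eq]
  rw [hasNormalizedDeriv_E₄.apply, hasNormalizedDeriv_E₆.apply,
    hasNormalizedDeriv_deriv_E₄.apply, hasNormalizedDeriv_deriv_E₆.apply,
    hasNormalizedDeriv_deriv_deriv_E₆.apply]
  exact this

end IsRecurrenceSequence

end QuasimodularRecurrence

namespace QuasimodularRecurrence

/-! ### Uniqueness of the decomposition -/

lemma IsModular.smul_apply {k : ℤ} {F : ℍ → ℂ} (h : IsModular k F) (γ : SL(2, ℤ)) (z : ℍ) :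
    F (γ • z) = denom γ z ^ k * F z := by
  have h1 := congrFun (h.slash_eq γ) z
  rw [SL_slash_apply, zpow_neg] at h1
  have := zpow_ne_zero k (denom_ne_zero γ z)
  rw [← h1]
  field_simp

lemma E2_smul_apply (γ : SL(2, ℤ)) (z : ℍ) :
    E2 (γ • z) = denom γ z ^ 2 *
      (E2 z + 12 * (2 * Real.pi * Complex.I)⁻¹ * (γ 1 0 / denom γ z)) := by
  rw [← E2_slash_apply, SL_slash_apply, zpow_neg]
  have := denom_ne_zero γ z
  norm_cast
  field_simp

/-- `1, E₂, E₂²` are linearly independent over modular forms (of matching weights). -/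
lemma eq_zero_of_decomposition {w : ℤ} {A B C : ℍ → ℂ} (hA : IsModular w A)
    (hB : IsModular (w - 2) B) (hC : IsModular (w - 4) C)
    (h : ∀ z, A z - 2 * E2 z * B z + E2 z ^ 2 * C z = 0) (z : ℍ) :
    A z = 0 ∧ B z = 0 ∧ C z = 0 := by
  set e : ℂ := (2 * Real.pi * Complex.I)⁻¹ with he
  have he0 : e ≠ 0 := inv_ne_zero Complex.two_pi_I_ne_zero
  -- Subtracting the relation at `z` from its transform at `γ • z` leaves an equation linear in the
  -- denominator. Its left side does not depend on `γ`, so two matrices with different denominators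
  -- at `z` force both sides to vanish.
  have key (γ : SL(2, ℤ)) (hγ : γ 1 0 = 1) :
      6 * e * C z = denom γ z * (B z - E2 z * C z) := by
    have hj := denom_ne_zero γ z
    have h1 := h (γ • z)
    have h0 := h z
    rw [hA.smul_apply, hB.smul_apply, hC.smul_apply, E2_smul_apply, ← he, hγ] at h1
    generalize denom γ z = j at *
    have h2 : j ^ (w - 2) = j ^ w / j ^ 2 := by rw [zpow_sub₀ hj]; norm_cast
    have h4 : j ^ (w - 4) = j ^ w / j ^ 4 := by rw [zpow_sub₀ hj]; norm_cast
    rw [h2, h4] at h1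
    have hjw := zpow_ne_zero w hj
    generalize j ^ w = t at *
    push_cast at h1
    field_simp at h1
    rw [mul_zero] at h1
    replace h1 := (mul_eq_zero.mp h1).resolve_left hjw
    clear_value e
    have h3 : 24 * e * (6 * e * C z - j * (B z - E2 z * C z)) = 0 := by
      linear_combination h1 - j ^ 2 * h0
    have h5 := (mul_eq_zero.mp h3).resolve_left (mul_ne_zero (by norm_num) he0)
    linear_combination h5
  -- The matrices `S` and `S T` have denominators `z` and `z + 1`.
  have k1 := key ModularGroup.S rfl
  have k2 := key (ModularGroup.S * ModularGroup.T) (by decide)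
  have d1 : denom (ModularGroup.S : SL(2, ℤ)) z = z := ModularGroup.denom_S z
  have e₀ : (ModularGroup.S * ModularGroup.T : SL(2, ℤ)) 1 0 = 1 := by decide
  have e₁ : (ModularGroup.S * ModularGroup.T : SL(2, ℤ)) 1 1 = 1 := by decide
  have d2 : denom (ModularGroup.S * ModularGroup.T : SL(2, ℤ)) z = z + 1 := by
    rw [ModularGroup.denom_apply, e₀, e₁]
    simp
  rw [d1] at k1
  rw [d2] at k2
  have hg : B z - E2 z * C z = 0 := by linear_combination k1 - k2
  rw [hg, mul_zero] at k1
  have hC0 : C z = 0 := (mul_eq_zero.mp k1).resolve_left (mul_ne_zero (by norm_num) he0)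
  have hB0 : B z = 0 := by rw [hC0] at hg; simpa using hg
  refine ⟨?_, hB0, hC0⟩
  have := h z
  rw [hB0, hC0] at this
  simpa using this

/-! ### Leading coefficients of the components -/

/-- The value at `i∞` of the component `C` of index `w = 4 k + 10`. -/
noncomputable def leadC : ℕ → ℂ
  | 0 => -1
  | k + 1 => leadC k * ((4 * k + 4) / (160 * (4 * k + 7) * (4 * k + 6) * (4 * k + 5)))

/-- The coefficient of `q` in `B - E₂ C`, for the index `w = 4 k + 10`. -/
noncomputable def leadG : ℕ → ℂ
  | 0 => -1008
  -- The ratio used below would contain the factor `0` at `k = -1`, so the product cannot start from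
  -- index `0`.
  | 1 => -(3 / 175)
  | k + 2 => leadG (k + 1) * ((4 * k + 4) / (160 * (4 * k + 11) * (4 * k + 9) * (4 * k - 2)))

lemma natCast_add_succ_ne_zero (a k b : ℕ) : ((a : ℂ) * k + (b + 1)) ≠ 0 := by
  exact_mod_cast (by omega : a * k + (b + 1) ≠ 0)

lemma four_mul_sub_two_ne_zero (k : ℕ) : ((4 : ℂ) * k - 2) ≠ 0 := by
  intro h
  have : (4 : ℂ) * k = 2 := by linear_combination h
  have : 4 * k = 2 := by exact_mod_cast this
  omega

lemma leadC_ne_zero (k : ℕ) : leadC k ≠ 0 := by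
  induction k with
  | zero => simp [leadC]
  | succ k ih =>
    have h4 := natCast_add_succ_ne_zero 4 k 3
    have h5 := natCast_add_succ_ne_zero 4 k 4
    have h6 := natCast_add_succ_ne_zero 4 k 5
    have h7 := natCast_add_succ_ne_zero 4 k 6
    norm_num at h4 h5 h6 h7
    exact mul_ne_zero ih (div_ne_zero h4
      (mul_ne_zero (mul_ne_zero (mul_ne_zero (by norm_num) h7) h6) h5))

lemma leadG_ne_zero : ∀ k : ℕ, leadG k ≠ 0
  | 0 => by norm_num [leadG]
  | 1 => by norm_num [leadG]
  | k + 2 => by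
    have h4 := natCast_add_succ_ne_zero 4 k 3
    have h9 := natCast_add_succ_ne_zero 4 k 8
    have h11 := natCast_add_succ_ne_zero 4 k 10
    have h2 := four_mul_sub_two_ne_zero k
    norm_num at h4 h9 h11
    exact mul_ne_zero (leadG_ne_zero (k + 1)) (div_ne_zero h4
      (mul_ne_zero (mul_ne_zero (mul_ne_zero (by norm_num) h11) h9) h2))

/-- This is the recurrence at the cusp, where `E₄ = 1` and `Δ = 0`. The two-term product solves this
three-term relation, and non-vanishing can be read off factor by factor. -/
lemma leadC_rec (k : ℕ) : recDen (4 * k + 18) * leadC (k + 3) =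
    recA (4 * k + 18) * leadC (k + 2) - recB (4 * k + 18) * leadC (k + 1) := by
  have h9 := natCast_add_succ_ne_zero 4 k 8
  have h10 := natCast_add_succ_ne_zero 4 k 9
  have h11 := natCast_add_succ_ne_zero 4 k 10
  have h13 := natCast_add_succ_ne_zero 4 k 12
  have h14 := natCast_add_succ_ne_zero 4 k 13
  have h15 := natCast_add_succ_ne_zero 4 k 14
  norm_num at h9 h10 h11 h13 h14 h15
  rw [leadC, leadC]
  generalize leadC (k + 1) = t
  push_cast
  rw [show (4 * ((k : ℂ) + 1) + 7) = 4 * k + 11 by ring,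
    show (4 * ((k : ℂ) + 1) + 6) = 4 * k + 10 by ring,
    show (4 * ((k : ℂ) + 1) + 5) = 4 * k + 9 by ring,
    show (4 * ((k : ℂ) + 2) + 7) = 4 * k + 15 by ring,
    show (4 * ((k : ℂ) + 2) + 6) = 4 * k + 14 by ring,
    show (4 * ((k : ℂ) + 2) + 5) = 4 * k + 13 by ring, recDen, recA, recB]
  field_simp
  ring

/-- Only indices from `1` on occur, so the exceptional value `leadG 0` does not interfere. -/
lemma leadG_rec (k : ℕ) : recDen (4 * k + 18) * leadG (k + 3) =
    recA (4 * k + 18) * leadG (k + 2) - recB (4 * k + 18) * leadG (k + 1) := by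
  have h9 := natCast_add_succ_ne_zero 4 k 8
  have h11 := natCast_add_succ_ne_zero 4 k 10
  have h13 := natCast_add_succ_ne_zero 4 k 12
  have h15 := natCast_add_succ_ne_zero 4 k 14
  have h2 := natCast_add_succ_ne_zero 4 k 1
  have h2' := four_mul_sub_two_ne_zero k
  norm_num at h9 h11 h13 h15 h2
  rw [leadG, leadG]
  generalize leadG (k + 1) = t
  push_cast
  rw [show (4 * ((k : ℂ) + 1) + 11) = 4 * k + 15 by ring,
    show (4 * ((k : ℂ) + 1) + 9) = 4 * k + 13 by ring,
    show (4 * ((k : ℂ) + 1) - 2) = 4 * k + 2 by ring, recDen, recA, recB]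
  field_simp
  ring

/-! ### Existence of the decomposition -/

/-- The combination of three functions prescribed by the recurrence at `w`. -/
noncomputable def recComb (w : ℂ) (X₀ X₁ X₂ : ℍ → ℂ) : ℍ → ℂ := fun z =>
  (recDen w)⁻¹ * (recA w * (E₄ z * X₂ z) - recB w * (E₄ z ^ 2 * X₁ z) + discriminant z * X₀ z)

lemma isModular_recComb {k : ℤ} (w : ℂ) {X₀ X₁ X₂ : ℍ → ℂ} (h₀ : IsModular k X₀)
    (h₁ : IsModular (k + 4) X₁) (h₂ : IsModular (k + 8) X₂) :
    IsModular (k + 12) (recComb w X₀ X₁ X₂) := by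
  have a₂ := ((isModular_E₄.mul h₂).const_mul (recA w)).congr (l := k + 12) (fun _ => rfl) (by ring)
  have a₁ := (((isModular_E₄.mul isModular_E₄).mul h₁).const_mul (recB w)).congr (l := k + 12)
    (fun _ => rfl) (by ring)
  have a₀ := (isModular_discriminant.mul h₀).congr (l := k + 12) (fun _ => rfl) (by ring)
  exact (((a₂.sub a₁).add a₀).const_mul (recDen w)⁻¹).congr
    (fun z => by rw [recComb]; ring) rfl

lemma hasLeadingTerm_recComb (w : ℂ) {X₀ X₁ X₂ : ℍ → ℂ} {n : ℕ} {c₀ c₁ c₂ : ℂ}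
    (h₀ : HasLeadingTerm X₀ n c₀) (h₁ : HasLeadingTerm X₁ n c₁) (h₂ : HasLeadingTerm X₂ n c₂) :
    HasLeadingTerm (recComb w X₀ X₁ X₂) n ((recDen w)⁻¹ * (recA w * c₂ - recB w * c₁)) := by
  -- The discriminant raises the order of `X₀` by one, so this term adds nothing to the coefficient
  -- of `q ^ n`.
  obtain ⟨d, hd⟩ := hasLeadingTerm_discriminant
  have h := hd.mul h₀
  rw [add_comm 1 n] at h
  have a₂ := (hasLeadingTerm_E₄.mul h₂).const_mul (recA w)
  have a₁ := ((hasLeadingTerm_E₄.pow 2).mul h₁).const_mul (recB w)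
  rw [zero_add, one_mul] at a₂
  rw [zero_add, one_pow, one_mul] at a₁
  have := ((a₂.sub a₁).add h.weaken).const_mul (recDen w)⁻¹
  rwa [add_zero] at this

/-- `A`, `B`, `C` are the components of `f (4 k + 10)`, with the expected leading terms. -/
structure IsComponents (f : ℕ → ℍ → ℂ) (k : ℕ) (A B C : ℍ → ℂ) : Prop where
  modular_A : IsModular (4 * k + 10) A
  modular_B : IsModular (4 * k + 8) B
  modular_C : IsModular (4 * k + 6) C
  eq : ∀ z, f (4 * k + 10) z = A z - 2 * E2 z * B z + E2 z ^ 2 * C z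
  lead_C : HasLeadingTerm C 0 (leadC k)
  lead_G : HasLeadingTerm (fun z => B z - E2 z * C z) 1 (leadG k)

namespace IsRecurrenceSequence

variable {f : ℕ → ℍ → ℂ}

lemma components_zero (hf : IsRecurrenceSequence f) : ∃ A B C, IsComponents f 0 A B C := by
  refine ⟨fun z => -1 * (E₄ z * E₆ z), fun z => -1 * (E₄ z * E₄ z), fun z => -1 * E₆ z,
    (isModular_E₄.mul isModular_E₆).const_mul _, (isModular_E₄.mul isModular_E₄).const_mul _,
    isModular_E₆.const_mul _, fun z => ?_, ?_, ?_⟩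
  · rw [Nat.mul_zero, Nat.zero_add, hf.init_ten]; ring
  · have := hasLeadingTerm_E₆.const_mul (-1)
    rwa [mul_one] at this
  -- By Ramanujan `B - E2 C` equals `2 D E₆`, which makes its order `q` visible; in weights `14` and
  -- `18` it is likewise a combination of `D E₄` and `D E₆`.
  · have := hasLeadingTerm_deriv_E₆.const_mul 2
    rw [show (2 : ℂ) * -504 = leadG 0 by norm_num [leadG]] at this
    exact this.congr fun z => by rw [hasNormalizedDeriv_E₆.apply]; ring

lemma components_one (hf : IsRecurrenceSequence f) : ∃ A B C, IsComponents f 1 A B C := by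
  have m4 := isModular_E₄
  have m6 := isModular_E₆
  refine ⟨fun z => -(1 / 8400) * (E₄ z * (E₄ z * E₆ z)),
    fun z => -(1 / 16800) * (E₄ z * (E₄ z * E₄ z) + E₆ z * E₆ z),
    fun z => -(1 / 8400) * (E₄ z * E₆ z), (m4.mul (m4.mul m6)).const_mul _,
    ((m4.mul (m4.mul m4)).add ((m6.mul m6).congr (fun _ => rfl) (by norm_num))).const_mul _,
    (m4.mul m6).const_mul _, fun z => ?_, ?_, ?_⟩
  · rw [show 4 * 1 + 10 = 14 by norm_num, hf.init_fourteen]; ring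
  · have := (hasLeadingTerm_E₄.mul hasLeadingTerm_E₆).const_mul (-(1 / 8400))
    convert this using 1
    norm_num [leadC]
  · have := (((hasLeadingTerm_E₄.mul hasLeadingTerm_deriv_E₆).const_mul 2).add
      ((hasLeadingTerm_E₆.mul hasLeadingTerm_deriv_E₄).const_mul 3)).const_mul (1 / 16800)
    convert this.congr (F₂ := fun z => -(1 / 16800) * (E₄ z * (E₄ z * E₄ z) + E₆ z * E₆ z)
      - E2 z * (-(1 / 8400) * (E₄ z * E₆ z))) (fun z => by
        rw [hasNormalizedDeriv_E₆.apply, hasNormalizedDeriv_E₄.apply]; ring) using 1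
    norm_num [leadG]

lemma components_two (hf : IsRecurrenceSequence f) : ∃ A B C, IsComponents f 2 A B C := by
  have m4 := isModular_E₄
  have m6 := isModular_E₆
  have m44 := m4.mul m4
  have m66 := m6.mul m6
  refine ⟨fun z => -(1 / 1995840000) * (5 * (E₄ z * E₄ z * (E₄ z * E₆ z))
      + 7 * (E₆ z * E₆ z * E₆ z)),
    fun z => -(1 / 3991680000) * (5 * (E₄ z * E₄ z * (E₄ z * E₄ z))
      + 19 * (E₄ z * (E₆ z * E₆ z))),
    fun z => -(12 / 1995840000) * (E₄ z * E₄ z * E₆ z),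
    (((m44.mul (m4.mul m6)).const_mul 5).add
      (((m66.mul m6).const_mul 7).congr (fun _ => rfl) (by norm_num))).const_mul _,
    (((m44.mul m44).const_mul 5).add
      (((m4.mul m66).const_mul 19).congr (fun _ => rfl) (by norm_num))).const_mul _,
    (m44.mul m6).const_mul _, fun z => ?_, ?_, ?_⟩
  · rw [show 4 * 2 + 10 = 18 by norm_num, hf.init_eighteen]; ring
  · have := ((hasLeadingTerm_E₄.mul hasLeadingTerm_E₄).mul hasLeadingTerm_E₆).const_mul
      (-(12 / 1995840000))
    convert this using 1
    norm_num [leadC]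
  · have := ((((hasLeadingTerm_E₄.mul hasLeadingTerm_E₄).mul
      hasLeadingTerm_deriv_E₆).const_mul 10).add
      (((hasLeadingTerm_E₄.mul hasLeadingTerm_E₆).mul
        hasLeadingTerm_deriv_E₄).const_mul 57)).const_mul (1 / 3991680000)
    convert this.congr (F₂ := fun z => -(1 / 3991680000) * (5 * (E₄ z * E₄ z * (E₄ z * E₄ z))
      + 19 * (E₄ z * (E₆ z * E₆ z)))
      - E2 z * (-(12 / 1995840000) * (E₄ z * E₄ z * E₆ z))) (fun z => by
        rw [hasNormalizedDeriv_E₆.apply, hasNormalizedDeriv_E₄.apply]; ring) using 1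
    norm_num [leadG]

lemma components_step (hf : IsRecurrenceSequence f) {k : ℕ}
    {A₀ B₀ C₀ A₁ B₁ C₁ A₂ B₂ C₂ : ℍ → ℂ} (h₀ : IsComponents f k A₀ B₀ C₀)
    (h₁ : IsComponents f (k + 1) A₁ B₁ C₁) (h₂ : IsComponents f (k + 2) A₂ B₂ C₂) :
    IsComponents f (k + 3) (recComb (4 * k + 18) A₀ A₁ A₂) (recComb (4 * k + 18) B₀ B₁ B₂)
      (recComb (4 * k + 18) C₀ C₁ C₂) := by
  have hN : recDen (4 * k + 18) ≠ 0 := by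
    have := recDen_ne_zero (v := 4 * k + 10) (by omega)
    push_cast at this
    rwa [show (4 * (k : ℂ) + 10 + 8) = 4 * k + 18 by ring] at this
  refine ⟨?_, ?_, ?_, fun z => ?_, ?_, ?_⟩
  · exact (isModular_recComb (4 * k + 18) h₀.modular_A
      (h₁.modular_A.congr (fun _ => rfl) (by push_cast; ring))
      (h₂.modular_A.congr (fun _ => rfl) (by push_cast; ring))).congr (fun _ => rfl)
      (by push_cast; ring)
  · exact (isModular_recComb (4 * k + 18) h₀.modular_B
      (h₁.modular_B.congr (fun _ => rfl) (by push_cast; ring))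
      (h₂.modular_B.congr (fun _ => rfl) (by push_cast; ring))).congr (fun _ => rfl)
      (by push_cast; ring)
  · exact (isModular_recComb (4 * k + 18) h₀.modular_C
      (h₁.modular_C.congr (fun _ => rfl) (by push_cast; ring))
      (h₂.modular_C.congr (fun _ => rfl) (by push_cast; ring))).congr (fun _ => rfl)
      (by push_cast; ring)
  · have hr := hf.recurrenceRel (v := 4 * k + 10) (by omega) (by omega) z
    have e₁ := h₁.eq z
    have e₂ := h₂.eq z
    rw [show 4 * (k + 1) + 10 = 4 * k + 10 + 4 by ring] at e₁
    rw [show 4 * (k + 2) + 10 = 4 * k + 10 + 8 by ring] at e₂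
    push_cast at hr
    rw [RecurrenceRel, show (4 * (k : ℂ) + 10 + 8) = 4 * k + 18 by ring,
      ← eq_inv_mul_iff_mul_eq₀ hN] at hr
    rw [show 4 * (k + 3) + 10 = 4 * k + 10 + 12 by ring, hr, h₀.eq, e₁, e₂]
    simp only [recComb]
    ring
  · have := hasLeadingTerm_recComb (4 * k + 18) h₀.lead_C h₁.lead_C h₂.lead_C
    rwa [← leadC_rec, inv_mul_cancel_left₀ hN] at this
  · have := hasLeadingTerm_recComb (4 * k + 18) h₀.lead_G h₁.lead_G h₂.lead_G
    rw [← leadG_rec, inv_mul_cancel_left₀ hN] at this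
    exact this.congr fun z => by simp only [recComb]; ring

theorem exists_components (hf : IsRecurrenceSequence f) (k : ℕ) :
    ∃ A B C, IsComponents f k A B C := by
  induction k using Nat.strong_induction_on with
  | _ k ih =>
    match k, ih with
    | 0, _ => exact hf.components_zero
    | 1, _ => exact hf.components_one
    | 2, _ => exact hf.components_two
    | k + 3, ih =>
      obtain ⟨_, _, _, h₀⟩ := ih k (by omega)
      obtain ⟨_, _, _, h₁⟩ := ih (k + 1) (by omega)
      obtain ⟨_, _, _, h₂⟩ := ih (k + 2) (by omega)
      exact ⟨_, _, _, hf.components_step h₀ h₁ h₂⟩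

end IsRecurrenceSequence

end QuasimodularRecurrence

namespace QuasimodularRecurrence

namespace IsRecurrenceSequence

variable {f : ℕ → ℍ → ℂ}

/-! ### Vanishing orders -/

/-- These crude lower bounds suffice: they serve only to exclude the indicial roots `0` and, for `w
≥ 14`, `1`. -/
lemma exists_hasLeadingTerm (hf : IsRecurrenceSequence f) :
    ∀ w, 10 ≤ w → w % 4 = 2 → (∃ c, HasLeadingTerm (f w) 1 c) ∧
      (14 ≤ w → ∃ c, HasLeadingTerm (f w) 2 c) := by
  have h46 := hasLeadingTerm_deriv_E₄.mul hasLeadingTerm_deriv_E₆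
  refine index_induction ⟨?_, by simp⟩ ?_ ?_ fun v hv hv4 h0 h1 h2 => ?_
  · have h1 := (hasLeadingTerm_E₄.mul hasLeadingTerm_deriv_E₄).const_mul 3
    have h2 := (hasLeadingTerm_E2.mul hasLeadingTerm_deriv_E₆).const_mul 2
    exact ⟨_, (h1.sub h2).congr hf.init_ten_eq⟩
  · have h := (h46.const_mul (-(6 / 8400))).congr hf.init_fourteen_eq
    exact ⟨⟨_, h.weaken⟩, fun _ => ⟨_, h⟩⟩
  · obtain ⟨c, hc⟩ := hasLeadingTerm_discriminant
    have h1 := (hasLeadingTerm_E₄.mul h46).const_mul 72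
    have h2 := (hc.mul hasLeadingTerm_deriv_E₄).const_mul 36288
    have h := ((h1.add h2).const_mul (-(1 / 1995840000))).congr hf.init_eighteen_eq
    exact ⟨⟨_, h.weaken⟩, fun _ => ⟨_, h⟩⟩
  · obtain ⟨d, hd⟩ := hasLeadingTerm_discriminant
    -- Order `1` is enough for the oldest term, since it is multiplied by `Δ`; this covers `v = 10`.
    obtain ⟨c₀, h0⟩ := h0.1
    obtain ⟨c₁, h1⟩ := h1.2 (by omega)
    obtain ⟨c₂, h2⟩ := h2.2 (by omega)
    have a₂ := (hasLeadingTerm_E₄.mul h2).const_mul (recA (v + 8))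
    have a₁ := ((hasLeadingTerm_E₄.pow 2).mul h1).const_mul (recB (v + 8))
    rw [zero_add] at a₂ a₁
    have h := (((a₂.sub a₁).add (hd.mul h0)).const_mul (recDen (v + 8))⁻¹).congr
      (F₂ := f (v + 12)) fun z => by
        have hr := hf.recurrenceRel hv hv4 z
        rw [RecurrenceRel, ← eq_inv_mul_iff_mul_eq₀ (recDen_ne_zero hv)] at hr
        rw [hr]
    exact ⟨⟨_, h.weaken⟩, fun _ => ⟨_, h⟩⟩

/-- If `f` vanished, independence of `1`, `E2`, `E2 ^ 2` would give `C = 0`, against its non-zero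
value at the cusp. -/
lemma ne_zero (hf : IsRecurrenceSequence f) (k : ℕ) : f (4 * k + 10) ≠ 0 := by
  intro h0
  obtain ⟨A, B, C, h⟩ := hf.exists_components k
  have hC (z : ℍ) : C z = 0 := (eq_zero_of_decomposition h.modular_A
    (h.modular_B.congr (fun _ => rfl) (by ring)) (h.modular_C.congr (fun _ => rfl) (by ring))
    (fun z => by rw [← h.eq, h0]; rfl) z).2.2
  exact leadC_ne_zero k (h.lead_C.unique ((HasLeadingTerm.const 0).congr hC))

end IsRecurrenceSequence

/-! ### Indicial equation at the cusp and the exact order. -/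

/-- The exponents at `i∞` of the differential equation are `0`, `1` and `(w - 6) / 4`. -/
lemma SolvesODE.exponent {w : ℂ} {F : ℍ → ℂ} (h : SolvesODE w F) {n : ℕ} {d : ℂ}
    (hd : d ≠ 0) (hF : HasLeadingTerm F n d) : (n : ℂ) * (n - 1) * (n - (w - 6) / 4) = 0 := by
  have hQ := hasLeadingTerm_E₄
  have hR := hasLeadingTerm_E₆
  have hQ₁ := hasLeadingTerm_deriv_E₄
  have hR₁ := hasLeadingTerm_deriv_E₆
  -- Every coefficient term containing a derivative of `E₄` or `E₆` vanishes at the cusp, so the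
  -- limit polynomial is `n³ - (w - 2) / 4 * n² + (w - 6) / 4 * n`.
  have t₃ := hR.mul hF.deriv.deriv.deriv
  have t₂ := (((hQ.pow 2).const_mul ((w - 2) / 4)).add (hR₁.weaken.const_mul (w / 2))).mul
    hF.deriv.deriv
  have t₁ := ((((hQ.mul hR).const_mul ((w - 6) / 4)).add
    ((hQ.mul hQ₁).weaken.const_mul ((w - 1) * (w - 2) / 8))).add
    (hR₁.deriv.weaken.const_mul (w * (w - 1) / 14))).mul hF.deriv
  have t₀ := (((((hQ.mul hR₁).weaken.const_mul ((w - 2) * (w - 6) / 24)).add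
    ((hQ₁.weaken.pow 2).const_mul (5 * (w - 8) * (w - 9) * (w - 10) / 384))).add
    ((hQ.mul hQ₁.deriv).weaken.const_mul
      ((w ^ 3 + 105 * w ^ 2 - 1162 * w + 3576) / 480))).add
    (hR₁.deriv.deriv.weaken.const_mul (w * (w - 1) * (w - 2) / 336))).mul hF
  have t := ((t₃.sub t₂).add t₁).sub t₀
  rw [zero_add] at t
  have h0 : HasLeadingTerm (fun _ => 0) n 0 := ⟨fun _ => 0, analyticAt_const, rfl, by simp⟩
  have := t.unique (h0.congr h)
  refine (mul_eq_zero.mp ?_).resolve_right hd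
  linear_combination this

namespace IsRecurrenceSequence

variable {f : ℕ → ℍ → ℂ}

theorem hasExactOrder (hf : IsRecurrenceSequence f) (k : ℕ) :
    HasExactOrder (f (4 * k + 10)) (k + 1) := by
  obtain ⟨⟨c, hc⟩, hc'⟩ := hf.exists_hasLeadingTerm (4 * k + 10) (by omega) (by omega)
  obtain ⟨n, d, hd, hn⟩ := hc.exists_ne_zero
    (hf.mdifferentiable (4 * k + 10) (by omega) (by omega)) (hf.ne_zero k)
  have hexp := (hf.solvesODE (w := 4 * k + 10) (by omega) (by omega)).exponent hd hn
  have h1 := hn.le_of_ne_zero hd hc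
  suffices n = k + 1 by
    subst this
    exact hn.hasExactOrder hd
  rcases mul_eq_zero.mp hexp with h | h
  · rcases mul_eq_zero.mp h with h | h
    · have : n = 0 := by exact_mod_cast h
      omega
    · have hn1 : n = 1 := by exact_mod_cast sub_eq_zero.mp h
      -- For `w = 10` the roots `1` and `(w - 6) / 4` coincide; for larger `w` vanishing to order
      -- `2` excludes the root `1`.
      rcases k with _ | k
      · exact hn1
      · obtain ⟨c', h2⟩ := hc' (by omega)
        have := hn.le_of_ne_zero hd h2
        omega
  · have : (n : ℂ) = (k + 1 : ℕ) := by
      push_cast at h ⊢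
      linear_combination h
    exact_mod_cast this

end IsRecurrenceSequence

/-! ### The components as modular forms -/

lemma IsDecomposition.unique {w : ℤ} {F : ℍ → ℂ} {A A' : ModularForm 𝒮ℒ w}
    {B B' : ModularForm 𝒮ℒ (w - 2)} {C C' : ModularForm 𝒮ℒ (w - 4)}
    (h : IsDecomposition w F A B C) (h' : IsDecomposition w F A' B' C') :
    A = A' ∧ B = B' ∧ C = C' := by
  have key := eq_zero_of_decomposition (IsModular.sub ⟨A, rfl⟩ ⟨A', rfl⟩)
    (IsModular.sub ⟨B, rfl⟩ ⟨B', rfl⟩) (IsModular.sub ⟨C, rfl⟩ ⟨C', rfl⟩)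
    (fun z => by linear_combination h' z - h z)
  exact ⟨ModularForm.ext fun z => sub_eq_zero.mp (key z).1,
    ModularForm.ext fun z => sub_eq_zero.mp (key z).2.1,
    ModularForm.ext fun z => sub_eq_zero.mp (key z).2.2⟩

namespace IsRecurrenceSequence

variable {f : ℕ → ℍ → ℂ}

theorem exists_isDecomposition (hf : IsRecurrenceSequence f) (k : ℕ) :
    ∃ (A : ModularForm 𝒮ℒ ((4 * k + 10 : ℕ) : ℤ)) (B : ModularForm 𝒮ℒ (((4 * k + 10 : ℕ) : ℤ) - 2))
      (C : ModularForm 𝒮ℒ (((4 * k + 10 : ℕ) : ℤ) - 4)),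
      IsDecomposition (4 * k + 10 : ℕ) (f (4 * k + 10)) A B C ∧
      HasExactOrder (fun z => B z - E2 z * C z) 1 ∧ HasExactOrder C 0 := by
  obtain ⟨A, B, C, h⟩ := hf.exists_components k
  obtain ⟨A, rfl⟩ := h.modular_A.congr (l := ((4 * k + 10 : ℕ) : ℤ)) (fun _ => rfl)
    (by push_cast; ring)
  obtain ⟨B, rfl⟩ := h.modular_B.congr (l := ((4 * k + 10 : ℕ) : ℤ) - 2) (fun _ => rfl)
    (by push_cast; ring)
  obtain ⟨C, rfl⟩ := h.modular_C.congr (l := ((4 * k + 10 : ℕ) : ℤ) - 4) (fun _ => rfl)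
    (by push_cast; ring)
  exact ⟨A, B, C, h.eq, h.lead_G.hasExactOrder (leadG_ne_zero k),
    h.lead_C.hasExactOrder (leadC_ne_zero k)⟩

/-! ### Initial elements as second derivatives -/

lemma init_ten_eq_deriv (hf : IsRecurrenceSequence f) (z : ℍ) :
    f 10 z = -(24 / 7) * (D^[2] E₆) z := by
  simp only [Function.iterate_succ, Function.iterate_zero, Function.comp_apply, id_eq]
  rw [hf.init_ten, hasNormalizedDeriv_deriv_E₆.apply]
  ring

lemma init_fourteen_eq_deriv (hf : IsRecurrenceSequence f) (z : ℍ) :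
    f 14 z = -(3 / 19250) * (D^[2] (fun τ => E₄ τ * E₆ τ)) z
      - 36 / 875 * (E2 z * discriminant z) := by
  have hQ := hasNormalizedDeriv_E₄.self
  have hR := hasNormalizedDeriv_E₆.self
  have hQ₁ := hasNormalizedDeriv_deriv_E₄.self
  have hR₁ := hasNormalizedDeriv_deriv_E₆.self
  obtain ⟨-, e⟩ := (hQ.mul hR).iterate ((hQ₁.mul hR).add (hQ.mul hR₁)) z
  simp only [Function.iterate_succ, Function.iterate_zero, Function.comp_apply, id_eq]
  rw [e, hf.init_fourteen, hasNormalizedDeriv_deriv_E₄.apply, hasNormalizedDeriv_deriv_E₆.apply,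
    hasNormalizedDeriv_E₄.apply, hasNormalizedDeriv_E₆.apply, discriminant_eq_E₄_cube_sub_E₆_sq]
  ring

lemma init_eighteen_eq_deriv (hf : IsRecurrenceSequence f) (z : ℍ) :
    f 18 z = -(1 / 242550000) * (D^[2] (fun τ => E₄ τ ^ 2 * E₆ τ)) z
      + discriminant z * (181 * E₆ z - 185 * (E2 z * E₄ z)) / 40425000 := by
  have hQ := hasNormalizedDeriv_E₄.self
  have hR := hasNormalizedDeriv_E₆.self
  have hQ₁ := hasNormalizedDeriv_deriv_E₄.self
  have hR₁ := hasNormalizedDeriv_deriv_E₆.self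
  have h := ((hQ.mul hQ).mul hR).congr (F₂ := fun τ => E₄ τ ^ 2 * E₆ τ) (fun τ => by ring)
    (fun _ => rfl)
  obtain ⟨-, e⟩ := h.iterate ((((hQ₁.mul hQ).add (hQ.mul hQ₁)).mul hR).add
    ((hQ.mul hQ).mul hR₁)) z
  simp only [Function.iterate_succ, Function.iterate_zero, Function.comp_apply, id_eq]
  rw [e, hf.init_eighteen, hasNormalizedDeriv_deriv_E₄.apply, hasNormalizedDeriv_deriv_E₆.apply,
    hasNormalizedDeriv_E₄.apply, hasNormalizedDeriv_E₆.apply, discriminant_eq_E₄_cube_sub_E₆_sq]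
  ring

end IsRecurrenceSequence

end QuasimodularRecurrence

/-! ### Assembly of the theorem. -/

theorem proposition5p3 (f : ℕ → ℍ → ℂ)
    (hf : QuasimodularRecurrence.IsRecurrenceSequence f) :
    -- the initial elements in terms of second derivatives
    (∀ z : ℍ, f 10 z = -(24 / 7) * (D^[2] E₆) z) ∧
    (∀ z : ℍ, f 14 z = -(3 / 19250) * (D^[2] (fun τ => E₄ τ * E₆ τ)) z
      - 36 / 875 * (E2 z * discriminant z)) ∧
    (∀ z : ℍ, f 18 z = -(1 / 242550000) * (D^[2] (fun τ => E₄ τ ^ 2 * E₆ τ)) z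
      + discriminant z * (181 * E₆ z - 185 * (E2 z * E₄ z)) / 40425000) ∧
    ∀ w : ℕ, 10 ≤ w → w % 4 = 2 →
      -- the differential equation
      QuasimodularRecurrence.SolvesODE w (f w) ∧
      -- quasimodularity of weight `w`, and uniqueness of the components
      (∃! p : ModularForm 𝒮ℒ (w : ℤ) × ModularForm 𝒮ℒ ((w : ℤ) - 2) × ModularForm 𝒮ℒ ((w : ℤ) - 4),
        QuasimodularRecurrence.IsDecomposition w (f w) p.1 p.2.1 p.2.2) ∧
      -- the exact orders of `f w`, `g w = B - E₂ C` and `h w = C`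
      QuasimodularRecurrence.HasExactOrder (f w) ((w - 6) / 4) ∧
      ∀ (A : ModularForm 𝒮ℒ (w : ℤ)) (B : ModularForm 𝒮ℒ ((w : ℤ) - 2))
        (C : ModularForm 𝒮ℒ ((w : ℤ) - 4)),
        QuasimodularRecurrence.IsDecomposition w (f w) A B C →
          QuasimodularRecurrence.HasExactOrder (fun z => B z - E2 z * C z) 1 ∧
          QuasimodularRecurrence.HasExactOrder C 0 := by
  refine ⟨hf.init_ten_eq_deriv, hf.init_fourteen_eq_deriv, hf.init_eighteen_eq_deriv,
    fun w hw hw4 => ⟨hf.solvesODE hw hw4, ?_⟩⟩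
  obtain ⟨k, rfl⟩ : ∃ k, w = 4 * k + 10 := ⟨(w - 10) / 4, by omega⟩
  obtain ⟨A, B, C, h, hG, hC⟩ := hf.exists_isDecomposition k
  refine ⟨⟨(A, B, C), h, fun p hp => ?_⟩, ?_, fun A' B' C' h' => ?_⟩
  · obtain ⟨h₁, h₂, h₃⟩ := hp.unique h
    exact Prod.ext h₁ (Prod.ext h₂ h₃)
  -- The natural subtraction and division are exact for `w = 4 k + 10`.
  · rw [show (4 * k + 10 - 6) / 4 = k + 1 by omega]
    exact hf.hasExactOrder k
  · obtain ⟨rfl, rfl, rfl⟩ := h.unique h'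
    exact ⟨hG, hC⟩
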